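/- For positive integers $m,n$ let $\Gamma_{m,n}=P_m\,\square\,P_n$ be the $m\times n$ grid graph (first coordinate horizontal, increasing to the right; second coordinate vertical, increasing downward). A set $S\subseteq V(\Gamma_{m,n})$ is a perfect dominating set (PDS) if every vertex not in $S$ is adjacent to exactly one element of $S$. PDS-arrays. For $\delta\in\{0,1\}$ and positive integers $m,n,r,s$, a PDS-array with parameters $(m,n,r,s,\delta)$ is an array $\{(a_{i,j},b_{i,j}) : 0\le i<r,\ 0\le j<s\}$ of pairs of positive integers ($i$ is the column index and $j$ the row index) such that 1. if $i+j\equiv\delta \pmod 2$ then $a_{i,j}=1$ or $b_{i,j}=1$, for $0\le i<r$, $0\le j<s$; 2. $|a_{i,j+1}-a_{i,j}|\le 2$ for $0\le i<r$, $0\le j<s-1$; 3. $|b_{i+1,j}-b_{i,j}|\le 2$ for $0\le i<r-1$, $0\le j<s$; 4. $\bigl|\sum_{i=0}^{k}a_{i,j+1}-\sum_{i=0}^{k}a_{i,j}\bigr|\le 1$ for $0\le k<r$, $0\le j<s-1$; 5. $\bigl|\sum_{j=0}^{k}b_{i+1,j}-\sum_{j=0}^{k}b_{i,j}\bigr|\le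 1$ for $0\le i<r-1$, $0\le k<s$; 6. $\sum_{i=0}^{r-1}a_{i,j}=m+1$ for $0\le j<s$; 7. $\sum_{j=0}^{s-1}b_{i,j}=n+1$ for $0\le i<r$. Rooms and ladders. Let $\Gamma'_{m,n}\cong\Gamma_{m+2,n+2}$ be the grid graph that contains $\Gamma_{m,n}$ as the subgraph induced by its interior vertices. For a PDS $S$ of $\Gamma_{m,n}$ let $\mathcal H^S_{m,n}$ be the subgraph of $\Gamma'_{m,n}$ induced by the boundary cycle of $\Gamma'_{m,n}$ together with $V(\Gamma_{m,n})\setminus S$. A 4-cycle of $\Gamma'_{m,n}$ is good if it has a vertex in $S$, and bad otherwise; it is identified with the unit square that it spans. A room is a rectangle that is a union of good 4-cycles, whose boundary cycle lies in $\mathcal H^S_{m,n}$, and which has no vertex of $\mathcal H^S_{m,n}$ in its interior. A ladder is a maximal rectangle among those that are unions of bad 4-cycles. Theorem. For every PDS $S$ in a finite grid graph $\Gamma_{m,n}$ with $m,n\ge 1$, the rooms and ladders of $\mathcal H^S_{m,n}$ tile the rectangle spanned by $\Gamma'_{m,n}$, and there are positive integers $r,s$ and $\delta\in\{0,1\}$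 such that they can be arranged, each exactly once, as $(T_{i,j})_{0\le i<r,\,0\le j<s}$ so that $T_{i,j}$ is a ladder if $i+j\equiv\delta\pmod 2$ and a room otherwise, $T_{i+1,j}$ is adjacent to the right side of $T_{i,j}$, and $T_{i,j+1}$ is adjacent to the lower side of $T_{i,j}$ (adjacent meaning along a segment of positive length). The array $\phi(S)$ of the pairs $(a_{i,j},b_{i,j})$ of widths and heights of the $T_{i,j}$ does not depend on the choice of such an arrangement, and it is a PDS-array with parameters $(m,n,r,s,\delta)$. The assignment $\phi$, from the family of all PDSs in all finite grid graphs $\Gamma_{m,n}$ to the family of PDS-arrays, is injective: the array of pairs $\phi(S)$ determines $m$, $n$ and $S$. -/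

import Mathlib

open SimpleGraph

/-- `S` is a perfect dominating set of `G`: every vertex outside `S` is adjacent to exactly one
element of `S`. -/
def IsPerfectDominatingSet {V : Type*} (G : SimpleGraph V) (S : Set V) : Prop :=
  ∀ v, v ∉ S → ∃! u, u ∈ S ∧ G.Adj v u

/-- The `m × n` grid graph `Γ_{m,n} = P_m □ P_n`; the first coordinate is horizontal and increases
to the right, the second one is vertical and increases downward. -/
abbrev gridGraph (m n : ℕ) : SimpleGraph (Fin m × Fin n) :=
  pathGraph m □ pathGraph n

/-- The family of all perfect dominating sets in all finite grid graphs. -/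
structure GridPDS where
  m : ℕ
  n : ℕ
  m_pos : 0 < m
  n_pos : 0 < n
  S : Set (Fin m × Fin n)
  isPDS : IsPerfectDominatingSet (gridGraph m n) S

/-- An array of `r` columns and `s` rows of pairs `(a i j, b i j)` of natural numbers, where `i` is
the column index and `j` the row index. -/
structure PairArray where
  r : ℕ
  s : ℕ
  a : Fin r → Fin s → ℕ
  b : Fin r → Fin s → ℕ

/-- `A` is a PDS-array with parameters `m`, `n`, `r = A.r`, `s = A.s` and `δ`. -/
structure IsPDSArray (m n : ℕ) (δ : Fin 2) (A : PairArray) : Prop where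
  m_pos : 0 < m
  n_pos : 0 < n
  r_pos : 0 < A.r
  s_pos : 0 < A.s
  a_pos : ∀ i j, 0 < A.a i j
  b_pos : ∀ i j, 0 < A.b i j
  alternate : ∀ (i : Fin A.r) (j : Fin A.s),
    ((i : ℕ) + (j : ℕ)) % 2 = (δ : ℕ) → A.a i j = 1 ∨ A.b i j = 1
  a_diff : ∀ (i : Fin A.r) (j j' : Fin A.s), (j' : ℕ) = (j : ℕ) + 1 →
    |(A.a i j' : ℤ) - (A.a i j : ℤ)| ≤ 2
  b_diff : ∀ (i i' : Fin A.r) (j : Fin A.s), (i' : ℕ) = (i : ℕ) + 1 →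
    |(A.b i' j : ℤ) - (A.b i j : ℤ)| ≤ 2
  a_sum_diff : ∀ (k : Fin A.r) (j j' : Fin A.s), (j' : ℕ) = (j : ℕ) + 1 →
    |(∑ i ∈ Finset.Iic k, (A.a i j' : ℤ)) - ∑ i ∈ Finset.Iic k, (A.a i j : ℤ)| ≤ 1
  b_sum_diff : ∀ (i i' : Fin A.r) (k : Fin A.s), (i' : ℕ) = (i : ℕ) + 1 →
    |(∑ j ∈ Finset.Iic k, (A.b i' j : ℤ)) - ∑ j ∈ Finset.Iic k, (A.b i j : ℤ)| ≤ 1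
  a_sum : ∀ j : Fin A.s, ∑ i, A.a i j = m + 1
  b_sum : ∀ i : Fin A.r, ∑ j, A.b i j = n + 1

/-- The family of all PDS-arrays. -/
def PDSArray : Type :=
  {A : PairArray // ∃ (m n : ℕ) (δ : Fin 2), IsPDSArray m n δ A}

/-- The inclusion of `Γ_{m,n}` as the interior of the enlarged grid graph `Γ'_{m,n}`, whose vertices
are the pairs `(x, y)` with `x ≤ m + 1` and `y ≤ n + 1`. -/
def gridEmbed {m n : ℕ} (v : Fin m × Fin n) : ℕ × ℕ :=
  ((v.1 : ℕ) + 1, (v.2 : ℕ) + 1)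

/-- The vertices of `Γ'_{m,n}` that lie in `S`. -/
def GridPDS.dom (P : GridPDS) : Set (ℕ × ℕ) :=
  gridEmbed '' P.S

/-- The vertex set of `H^S_{m,n}`, the subgraph of `Γ'_{m,n}` induced by the boundary cycle of
`Γ'_{m,n}` together with the complement of `S` in `Γ_{m,n}`. -/
def GridPDS.hVertices (P : GridPDS) : Set (ℕ × ℕ) :=
  {v | v.1 ≤ P.m + 1 ∧ v.2 ≤ P.n + 1 ∧ (v.1 = 0 ∨ v.1 = P.m + 1 ∨ v.2 = 0 ∨ v.2 = P.n + 1)} ∪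
    gridEmbed '' (P.S)ᶜ

/-- The 4-cycle with corners `(x, y)`, `(x + 1, y)`, `(x, y + 1)`, `(x + 1, y + 1)` is good if it
contains an element of `S`; otherwise it is bad. -/
def GridPDS.Good (P : GridPDS) (x y : ℕ) : Prop :=
  (x, y) ∈ P.dom ∨ (x + 1, y) ∈ P.dom ∨ (x, y + 1) ∈ P.dom ∨ (x + 1, y + 1) ∈ P.dom

/-- The rectangle `[x, x + w] × [y, y + h]`. -/
structure LatticeRect where
  x : ℕ
  y : ℕ
  w : ℕ
  h : ℕ

/-- The rectangle contains the square spanned by the 4-cycle with least corner `(x, y)`. -/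
def LatticeRect.HasCell (R : LatticeRect) (x y : ℕ) : Prop :=
  R.x ≤ x ∧ x < R.x + R.w ∧ R.y ≤ y ∧ y < R.y + R.h

/-- The lattice point `v` lies in the (closed) rectangle. -/
def LatticeRect.HasPoint (R : LatticeRect) (v : ℕ × ℕ) : Prop :=
  R.x ≤ v.1 ∧ v.1 ≤ R.x + R.w ∧ R.y ≤ v.2 ∧ v.2 ≤ R.y + R.h

/-- The lattice point `v` lies in the interior of the rectangle. -/
def LatticeRect.HasInteriorPoint (R : LatticeRect) (v : ℕ × ℕ) : Prop :=
  R.x < v.1 ∧ v.1 < R.x + R.w ∧ R.y < v.2 ∧ v.2 < R.y + R.h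

/-- The rectangle is nondegenerate and contained in the region spanned by `Γ'_{m,n}`. -/
def GridPDS.Within (P : GridPDS) (R : LatticeRect) : Prop :=
  0 < R.w ∧ 0 < R.h ∧ R.x + R.w ≤ P.m + 1 ∧ R.y + R.h ≤ P.n + 1

/-- Rooms: rectangles that are unions of good 4-cycles and are delimited by holes of `H^S_{m,n}`:
the boundary cycle consists of vertices of `H^S_{m,n}` (an induced subgraph of `Γ'_{m,n}`) and no
vertex of `H^S_{m,n}` is inside. -/
structure GridPDS.IsRoom (P : GridPDS) (R : LatticeRect) : Prop where
  within : P.Within R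
  good : ∀ x y, R.HasCell x y → P.Good x y
  boundary : ∀ v, R.HasPoint v → ¬ R.HasInteriorPoint v → v ∈ P.hVertices
  interior : ∀ v, R.HasInteriorPoint v → v ∉ P.hVertices

/-- Ladders: maximal rectangles among those that are unions of bad 4-cycles. -/
structure GridPDS.IsLadder (P : GridPDS) (R : LatticeRect) : Prop where
  within : P.Within R
  bad : ∀ x y, R.HasCell x y → ¬ P.Good x y
  maximal : ∀ R' : LatticeRect, P.Within R' → (∀ x y, R'.HasCell x y → ¬ P.Good x y) →
    (∀ x y, R.HasCell x y → R'.HasCell x y) → R' = R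

/-- `R'` is adjacent to `R` at the right side of `R` (along a segment of positive length). -/
def LatticeRect.RightOf (R R' : LatticeRect) : Prop :=
  R'.x = R.x + R.w ∧ R.y < R'.y + R'.h ∧ R'.y < R.y + R.h

/-- `R'` is adjacent to `R` at the lower side of `R` (along a segment of positive length). -/
def LatticeRect.Below (R R' : LatticeRect) : Prop :=
  R'.y = R.y + R.h ∧ R.x < R'.x + R'.w ∧ R'.x < R.x + R.w

/-- `T` arranges all rooms and ladders of `H^S_{m,n}`, each of them once, in `r` columns and `s`
rows according to the room-ladder adjacencies; ladders occupy the places `(i, j)` with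
`i + j ≡ δ` mod 2 and rooms the other ones. Together they tile the region of `Γ'_{m,n}`. -/
structure GridPDS.IsArrangement (P : GridPDS) (δ : Fin 2) {r s : ℕ}
    (T : Fin r → Fin s → LatticeRect) : Prop where
  ladder : ∀ (i : Fin r) (j : Fin s), ((i : ℕ) + (j : ℕ)) % 2 = (δ : ℕ) → P.IsLadder (T i j)
  room : ∀ (i : Fin r) (j : Fin s), ((i : ℕ) + (j : ℕ)) % 2 ≠ (δ : ℕ) → P.IsRoom (T i j)
  once : ∀ (i i' : Fin r) (j j' : Fin s), T i j = T i' j' → i = i' ∧ j = j'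
  all : ∀ R, P.IsRoom R ∨ P.IsLadder R → ∃ i j, T i j = R
  tiles : ∀ x y, x ≤ P.m → y ≤ P.n → ∃! p : Fin r × Fin s, (T p.1 p.2).HasCell x y
  right : ∀ (i i' : Fin r) (j : Fin s), (i' : ℕ) = (i : ℕ) + 1 → (T i j).RightOf (T i' j)
  below : ∀ (i : Fin r) (j j' : Fin s), (j' : ℕ) = (j : ℕ) + 1 → (T i j).Below (T i j')

/-- `A` is the array of the widths and heights of the rooms and ladders of `H^S_{m,n}`. -/
def GridPDS.IsRoomLadderArray (P : GridPDS) (δ : Fin 2) (A : PairArray) : Prop :=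
  ∃ T : Fin A.r → Fin A.s → LatticeRect, P.IsArrangement δ T ∧
    ∀ i j, A.a i j = (T i j).w ∧ A.b i j = (T i j).h

/-! Two local facts govern the structure. If two opposite corners of a unit cell lie in `S`, another
corner outside `S` would have both a horizontal and a vertical neighbour in `S`; hence `S` falls
into full rectangles of lattice points, and these are the interiors of the rooms
(`exists_room_of_mem`). If three bad cells formed an L, their common vertex and its four neighbours
would all miss `S`; hence the bad cells form strips of width one, the ladders (`not_tromino`,
`exists_ladder`).

Along the right side of a room every non-corner point already has its left neighbour in `S`, so its
right neighbour is not in `S`. All cells next to that side are therefore bad, except perhaps the two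
extreme ones, and exactly one ladder lies along the side, with ends at distance at most one from the
ends of the side (`right_ladder_bounds`, `right_ladder_unique`). Conversely, a ladder side inside
the region meets exactly one room. By reflection in a vertical line and in the diagonal, every tile
has exactly one neighbour on each side that is not on the border, and rooms and ladders alternate.

The element of `S` that dominates a corner of a room belongs to a room touching both neighbouring
ladders. So steps to the right and steps down commute (`StepRight.comm_stepDown`), and the tiles
form a grid starting at the upper left corner. Uniqueness of steps shows that the grid contains
every tile once and that it is the only one.

Partial sums of widths and heights telescope to coordinates of sides, so the PDS-array conditions
are the bounds on a single step together with the thinness of ladders. Conversely, the sizes recover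
all rectangles; those with interior lattice points are the rooms, and their interiors make up `S`.
-/

/-! ### Perfect domination, rooms and ladders in integer coordinates -/

/-- `S` is a set of interior lattice points of `[0, M] × [0, N]` such that every other interior
point has exactly one neighbour in `S`. -/
structure IsPerfectConfig (M N : ℤ) (S : ℤ → ℤ → Prop) : Prop where
  inside : ∀ x y, S x y → 0 < x ∧ x < M ∧ 0 < y ∧ y < N
  dominated : ∀ x y, 0 < x → x < M → 0 < y → y < N → ¬ S x y →
    S (x - 1) y ∨ S (x + 1) y ∨ S x (y - 1) ∨ S x (y + 1)
  -- Uniqueness of the dominating neighbour, split into two neighbours on a line and two at a right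
  -- angle; this form is stable under reflections.
  horizontal : ∀ x y, ¬ S x y → ¬ (S (x - 1) y ∧ S (x + 1) y)
  vertical : ∀ x y, ¬ S x y → ¬ (S x (y - 1) ∧ S x (y + 1))
  corner : ∀ x y, 0 < x → x < M → 0 < y → y < N → ¬ S x y →
    ¬ ((S (x - 1) y ∨ S (x + 1) y) ∧ (S x (y - 1) ∨ S x (y + 1)))

/-- The rectangle `[x₁, x₂] × [y₁, y₂]`. -/
@[ext]
structure IntRect where
  x₁ : ℤ
  x₂ : ℤ
  y₁ : ℤ
  y₂ : ℤ

/-- The unit cell with least corner `(x, y)` lies in `[0, M] × [0, N]` and has no corner in `S`. -/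
def BadCell (M N : ℤ) (S : ℤ → ℤ → Prop) (x y : ℤ) : Prop :=
  0 ≤ x ∧ x < M ∧ 0 ≤ y ∧ y < N ∧
    ¬ S x y ∧ ¬ S (x + 1) y ∧ ¬ S x (y + 1) ∧ ¬ S (x + 1) (y + 1)

/-- `R` has all its interior lattice points and no boundary lattice point in `S`. -/
structure IsRoomRect (M N : ℤ) (S : ℤ → ℤ → Prop) (R : IntRect) : Prop where
  width : R.x₁ + 2 ≤ R.x₂
  height : R.y₁ + 2 ≤ R.y₂
  left : 0 ≤ R.x₁
  right : R.x₂ ≤ M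
  top : 0 ≤ R.y₁
  bottom : R.y₂ ≤ N
  inner : ∀ x y, R.x₁ < x → x < R.x₂ → R.y₁ < y → y < R.y₂ → S x y
  outer : ∀ x y, R.x₁ ≤ x → x ≤ R.x₂ → R.y₁ ≤ y → y ≤ R.y₂ →
    x = R.x₁ ∨ x = R.x₂ ∨ y = R.y₁ ∨ y = R.y₂ → ¬ S x y

/-- `R` is a union of bad cells and no bad cell outside is adjacent to it along a side. -/
structure IsLadderRect (M N : ℤ) (S : ℤ → ℤ → Prop) (R : IntRect) : Prop where
  width : R.x₁ < R.x₂
  height : R.y₁ < R.y₂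
  bad : ∀ x y, R.x₁ ≤ x → x < R.x₂ → R.y₁ ≤ y → y < R.y₂ → BadCell M N S x y
  left : ∀ y, R.y₁ ≤ y → y < R.y₂ → ¬ BadCell M N S (R.x₁ - 1) y
  right : ∀ y, R.y₁ ≤ y → y < R.y₂ → ¬ BadCell M N S R.x₂ y
  top : ∀ x, R.x₁ ≤ x → x < R.x₂ → ¬ BadCell M N S x (R.y₁ - 1)
  bottom : ∀ x, R.x₁ ≤ x → x < R.x₂ → ¬ BadCell M N S x R.y₂

/-- The cell with least corner `(x, y)` lies in `R`. -/
def IntRect.HasCell (R : IntRect) (x y : ℤ) : Prop :=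
  R.x₁ ≤ x ∧ x < R.x₂ ∧ R.y₁ ≤ y ∧ y < R.y₂

/-- `R'` touches the right side of `R` along a segment of positive length. -/
def IntRect.RightOf (R R' : IntRect) : Prop :=
  R'.x₁ = R.x₂ ∧ R.y₁ < R'.y₂ ∧ R'.y₁ < R.y₂

/-- The reflection of a rectangle that exchanges left and right. -/
def IntRect.flip (M : ℤ) (R : IntRect) : IntRect := ⟨M - R.x₂, M - R.x₁, R.y₁, R.y₂⟩

/-- The reflection of a rectangle in the diagonal. -/
def IntRect.swap (R : IntRect) : IntRect := ⟨R.y₁, R.y₂, R.x₁, R.x₂⟩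

@[simp] lemma IntRect.flip_flip (M : ℤ) (R : IntRect) : (R.flip M).flip M = R := by
  simp [IntRect.flip]

@[simp] lemma IntRect.swap_swap (R : IntRect) : R.swap.swap = R := rfl

/-! ### Symmetry under reflections -/

section Local

variable {M N : ℤ} {S : ℤ → ℤ → Prop}

lemma IsPerfectConfig.flip (h : IsPerfectConfig M N S) :
    IsPerfectConfig M N (fun x y => S (M - x) y) where
  inside x y hS := by have := h.inside _ _ hS; omega
  dominated x y h1 h2 h3 h4 hS := by
    have := h.dominated (M - x) y (by omega) (by omega) h3 h4 hS
    rw [show M - x - 1 = M - (x + 1) by ring, show M - x + 1 = M - (x - 1) by ring] at this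
    tauto
  horizontal x y hS := by
    have := h.horizontal (M - x) y hS
    rw [show M - x - 1 = M - (x + 1) by ring, show M - x + 1 = M - (x - 1) by ring] at this
    tauto
  vertical x y hS := h.vertical (M - x) y hS
  corner x y h1 h2 h3 h4 hS := by
    have := h.corner (M - x) y (by omega) (by omega) h3 h4 hS
    rw [show M - x - 1 = M - (x + 1) by ring, show M - x + 1 = M - (x - 1) by ring] at this
    tauto

lemma IsPerfectConfig.swap (h : IsPerfectConfig M N S) :
    IsPerfectConfig N M (fun x y => S y x) where
  inside x y hS := by have := h.inside _ _ hS; omega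
  dominated x y h1 h2 h3 h4 hS := by
    have := h.dominated y x h3 h4 h1 h2 hS
    tauto
  horizontal x y hS := h.vertical y x hS
  vertical x y hS := h.horizontal y x hS
  corner x y h1 h2 h3 h4 hS := by
    have := h.corner y x h3 h4 h1 h2 hS
    tauto

/-- Reflection exchanges the two vertical sides of a cell, so the new least corner comes from the
old right side; this is the source of the shift by one. -/
lemma badCell_flip {x y : ℤ} :
    BadCell M N (fun x y => S (M - x) y) x y ↔ BadCell M N S (M - x - 1) y := by
  unfold BadCell
  dsimp only
  rw [show M - x - 1 + 1 = M - x by ring, show M - (x + 1) = M - x - 1 by ring]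
  grind

lemma badCell_swap {x y : ℤ} : BadCell N M (fun x y => S y x) x y ↔ BadCell M N S y x := by
  unfold BadCell
  tauto

lemma isRoomRect_flip {R : IntRect} :
    IsRoomRect M N (fun x y => S (M - x) y) (R.flip M) ↔ IsRoomRect M N S R := by
  constructor <;> intro h
  · have h1 := h.width; have h2 := h.left; have h3 := h.right
    simp only [IntRect.flip] at h1 h2 h3
    refine ⟨by omega, h.height, by omega, by omega, h.top, h.bottom, fun x y a b c d => ?_,
      fun x y a b c d e => ?_⟩
    · simpa using h.inner (M - x) y (by simp only [IntRect.flip]; omega)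
        (by simp only [IntRect.flip]; omega) c d
    · simpa using h.outer (M - x) y (by simp only [IntRect.flip]; omega)
        (by simp only [IntRect.flip]; omega) c d (by simp only [IntRect.flip]; omega)
  · have h1 := h.width; have h2 := h.left; have h3 := h.right
    refine ⟨by simp only [IntRect.flip]; omega, h.height, by simp only [IntRect.flip]; omega,
      by simp only [IntRect.flip]; omega, h.top, h.bottom, ?_, ?_⟩
    · simp only [IntRect.flip]
      exact fun x y a b c d => h.inner _ _ (by omega) (by omega) c d
    · simp only [IntRect.flip]
      exact fun x y a b c d e => h.outer _ _ (by omega) (by omega) c d (by omega)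

lemma isRoomRect_swap {R : IntRect} :
    IsRoomRect N M (fun x y => S y x) R.swap ↔ IsRoomRect M N S R :=
  ⟨fun h => ⟨h.height, h.width, h.top, h.bottom, h.left, h.right,
      fun x y a b c d => h.inner y x c d a b,
      fun x y a b c d e => h.outer y x c d a b (by simp only [IntRect.swap]; tauto)⟩,
    fun h => ⟨h.height, h.width, h.top, h.bottom, h.left, h.right,
      fun x y a b c d => h.inner y x c d a b,
      fun x y a b c d e => h.outer y x c d a b (by simp only [IntRect.swap] at e; tauto)⟩⟩

lemma isLadderRect_flip {R : IntRect} :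
    IsLadderRect M N (fun x y => S (M - x) y) (R.flip M) ↔ IsLadderRect M N S R := by
  have e : ∀ x, M - (M - x - 1) - 1 = x := fun x => by ring
  constructor <;> intro h
  · have h1 := h.width
    have hb := h.bad; have hl := h.left; have hr := h.right
    have ht := h.top; have hm := h.bottom
    simp only [IntRect.flip, badCell_flip] at h1 hb hl hr ht hm
    refine ⟨by omega, h.height, fun x y a b c d => ?_, fun y a b => ?_, fun y a b => ?_,
      fun x a b => ?_, fun x a b => ?_⟩
    · simpa [e] using hb (M - x - 1) y (by omega) (by omega) c d
    · simpa [e] using hr y a b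
    · simpa [e] using hl y a b
    · simpa [e] using ht (M - x - 1) (by omega) (by omega)
    · simpa [e] using hm (M - x - 1) (by omega) (by omega)
  · have h1 := h.width
    refine ⟨by simp only [IntRect.flip]; omega, h.height, ?_, ?_, ?_, ?_, ?_⟩ <;>
      simp only [IntRect.flip, badCell_flip]
    · exact fun x y a b c d => h.bad _ _ (by omega) (by omega) c d
    · intro y a b
      simpa [e] using h.right y a b
    · intro y a b
      simpa [e] using h.left y a b
    · exact fun x a b => h.top _ (by omega) (by omega)
    · exact fun x a b => h.bottom _ (by omega) (by omega)

lemma isLadderRect_swap {R : IntRect} :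
    IsLadderRect N M (fun x y => S y x) R.swap ↔ IsLadderRect M N S R :=
  ⟨fun h => ⟨h.height, h.width, fun x y a b c d => badCell_swap.1 (h.bad y x c d a b),
      fun y a b => fun c => h.top y a b (badCell_swap.2 c),
      fun y a b => fun c => h.bottom y a b (badCell_swap.2 c),
      fun y a b => fun c => h.left y a b (badCell_swap.2 c),
      fun y a b => fun c => h.right y a b (badCell_swap.2 c)⟩,
    fun h => ⟨h.height, h.width, fun x y a b c d => badCell_swap.2 (h.bad y x c d a b),
      fun y a b => fun c => h.top y a b (badCell_swap.1 c),
      fun y a b => fun c => h.bottom y a b (badCell_swap.1 c),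
      fun y a b => fun c => h.left y a b (badCell_swap.1 c),
      fun y a b => fun c => h.right y a b (badCell_swap.1 c)⟩⟩

/-! ### Tiles that share a cell coincide -/

/-- A union of bad cells that shares a cell with a ladder lies in that ladder. -/
lemma IsLadderRect.le_of_hasCell {L R : IntRect} (hL : IsLadderRect M N S L)
    (hR : ∀ x y, R.HasCell x y → BadCell M N S x y) {x y : ℤ} (h : L.HasCell x y)
    (h' : R.HasCell x y) : L.x₁ ≤ R.x₁ ∧ R.x₂ ≤ L.x₂ ∧ L.y₁ ≤ R.y₁ ∧ R.y₂ ≤ L.y₂ := by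
  obtain ⟨a, b, c, d⟩ := h
  obtain ⟨a', b', c', d'⟩ := h'
  refine ⟨?_, ?_, ?_, ?_⟩ <;> by_contra hc
  · exact hL.left y c d (hR _ _ ⟨by omega, by omega, by omega, by omega⟩)
  · exact hL.right y c d (hR _ _ ⟨by omega, by omega, by omega, by omega⟩)
  · exact hL.top x a b (hR _ _ ⟨by omega, by omega, by omega, by omega⟩)
  · exact hL.bottom x a b (hR _ _ ⟨by omega, by omega, by omega, by omega⟩)

lemma IsLadderRect.badCell_of_hasCell {L : IntRect} (hL : IsLadderRect M N S L) {x y : ℤ}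
    (h : L.HasCell x y) : BadCell M N S x y :=
  hL.bad _ _ h.1 h.2.1 h.2.2.1 h.2.2.2

lemma IsLadderRect.eq_of_hasCell {L L' : IntRect} (hL : IsLadderRect M N S L)
    (hL' : IsLadderRect M N S L') {x y : ℤ} (h : L.HasCell x y) (h' : L'.HasCell x y) :
    L = L' := by
  have h1 := hL.le_of_hasCell (fun _ _ => hL'.badCell_of_hasCell) h h'
  have h2 := hL'.le_of_hasCell (fun _ _ => hL.badCell_of_hasCell) h' h
  ext <;> omega

lemma IsLadderRect.bounds {L : IntRect} (hL : IsLadderRect M N S L) :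
    0 ≤ L.x₁ ∧ L.x₁ < L.x₂ ∧ L.x₂ ≤ M ∧ 0 ≤ L.y₁ ∧ L.y₁ < L.y₂ ∧ L.y₂ ≤ N := by
  have hw := hL.width
  have hh := hL.height
  obtain ⟨a, b, c, d, -⟩ := hL.bad L.x₁ L.y₁ le_rfl hw le_rfl hh
  obtain ⟨a', b', c', d', -⟩ := hL.bad (L.x₂ - 1) (L.y₂ - 1) (by omega) (by omega) (by omega)
    (by omega)
  omega

/-- Every cell of a room has a corner in `S`, which is an interior point of the room. -/
lemma IsRoomRect.exists_corner {R : IntRect} (hR : IsRoomRect M N S R) {x y : ℤ}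
    (h : R.HasCell x y) : ∃ p q, S p q ∧ (p = x ∨ p = x + 1) ∧ (q = y ∨ q = y + 1) := by
  obtain ⟨a, b, c, d⟩ := h
  have hw := hR.width
  have hh := hR.height
  obtain ⟨p, hp, hp1, hp2⟩ : ∃ p, (p = x ∨ p = x + 1) ∧ R.x₁ < p ∧ p < R.x₂ := by
    rcases eq_or_lt_of_le a with e | e
    · exact ⟨x + 1, by omega, by omega, by omega⟩
    · exact ⟨x, by omega, by omega, by omega⟩
  obtain ⟨q, hq, hq1, hq2⟩ : ∃ q, (q = y ∨ q = y + 1) ∧ R.y₁ < q ∧ q < R.y₂ := by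
    rcases eq_or_lt_of_le c with e | e
    · exact ⟨y + 1, by omega, by omega, by omega⟩
    · exact ⟨y, by omega, by omega, by omega⟩
  exact ⟨p, q, hR.inner p q hp1 hp2 hq1 hq2, hp, hq⟩

lemma IsRoomRect.not_badCell {R : IntRect} (hR : IsRoomRect M N S R) {x y : ℤ}
    (h : R.HasCell x y) : ¬ BadCell M N S x y := by
  obtain ⟨p, q, hS, rfl | rfl, rfl | rfl⟩ := hR.exists_corner h <;>
    · unfold BadCell
      tauto

lemma IsRoomRect.interior_of_mem {R : IntRect} (hR : IsRoomRect M N S R) {x y : ℤ}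
    (h : S x y) (h1 : R.x₁ ≤ x) (h2 : x ≤ R.x₂) (h3 : R.y₁ ≤ y) (h4 : y ≤ R.y₂) :
    R.x₁ < x ∧ x < R.x₂ ∧ R.y₁ < y ∧ y < R.y₂ := by
  by_contra hc
  exact hR.outer x y h1 h2 h3 h4 (by omega) h

/-- If `R'` extended beyond a side of `R`, the projection of the common interior point to that side
would be interior to `R'`, hence in `S`, although it lies on the boundary of `R`. -/
lemma IsRoomRect.le_of_mem {R R' : IntRect} (hR : IsRoomRect M N S R)
    (hR' : IsRoomRect M N S R') {x y : ℤ} (h1 : R.x₁ < x) (h2 : x < R.x₂) (h3 : R.y₁ < y)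
    (h4 : y < R.y₂) (h1' : R'.x₁ < x) (h2' : x < R'.x₂) (h3' : R'.y₁ < y) (h4' : y < R'.y₂) :
    R.x₁ ≤ R'.x₁ ∧ R'.x₂ ≤ R.x₂ ∧ R.y₁ ≤ R'.y₁ ∧ R'.y₂ ≤ R.y₂ := by
  refine ⟨?_, ?_, ?_, ?_⟩ <;> by_contra hc
  · exact hR.outer R.x₁ y (by omega) (by omega) (by omega) (by omega) (by omega)
      (hR'.inner _ _ (by omega) (by omega) (by omega) (by omega))
  · exact hR.outer R.x₂ y (by omega) (by omega) (by omega) (by omega) (by omega)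
      (hR'.inner _ _ (by omega) (by omega) (by omega) (by omega))
  · exact hR.outer x R.y₁ (by omega) (by omega) (by omega) (by omega) (by omega)
      (hR'.inner _ _ (by omega) (by omega) (by omega) (by omega))
  · exact hR.outer x R.y₂ (by omega) (by omega) (by omega) (by omega) (by omega)
      (hR'.inner _ _ (by omega) (by omega) (by omega) (by omega))

lemma IsRoomRect.eq_of_hasCell {R R' : IntRect} (hR : IsRoomRect M N S R)
    (hR' : IsRoomRect M N S R') {x y : ℤ} (h : R.HasCell x y) (h' : R'.HasCell x y) :
    R = R' := by
  obtain ⟨p, q, hS, hp, hq⟩ := hR.exists_corner h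
  obtain ⟨a, b, c, d⟩ := h
  obtain ⟨a', b', c', d'⟩ := h'
  obtain ⟨i1, i2, i3, i4⟩ := hR.interior_of_mem hS (by omega) (by omega) (by omega) (by omega)
  obtain ⟨j1, j2, j3, j4⟩ := hR'.interior_of_mem hS (by omega) (by omega) (by omega) (by omega)
  have h1 := hR.le_of_mem hR' i1 i2 i3 i4 j1 j2 j3 j4
  have h2 := hR'.le_of_mem hR j1 j2 j3 j4 i1 i2 i3 i4
  ext <;> omega

/-! ### Rooms around the elements of `S` -/

/-- If two opposite corners of a unit cell are in `S`, then so is every other corner. -/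
lemma IsPerfectConfig.square (h : IsPerfectConfig M N S) {x y x' y' : ℤ}
    (hx : x' = x + 1 ∨ x' = x - 1) (hy : y' = y + 1 ∨ y' = y - 1) (h1 : S x y') (h2 : S x' y) :
    S x y := by
  by_contra hS
  have i1 := h.inside _ _ h1
  have i2 := h.inside _ _ h2
  refine h.corner x y (by omega) (by omega) (by omega) (by omega) hS ⟨?_, ?_⟩
  · rcases hx with rfl | rfl <;> tauto
  · rcases hy with rfl | rfl <;> tauto

/-- The last point of a run of points with property `p` that starts at `a`. -/
lemma exists_run_up (p : ℤ → Prop) {a B : ℤ} (ha : p a) (hB : ∀ x, p x → x < B) :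
    ∃ b, a < b ∧ (∀ x, a ≤ x → x < b → p x) ∧ ¬ p b := by
  classical
  have hex : ∃ k : ℕ, ¬ p (a + k) := by
    refine ⟨(B - a).toNat, fun hp => ?_⟩
    have := hB _ hp
    have := hB _ ha
    omega
  refine ⟨a + Nat.find hex, ?_, fun x h1 h2 => ?_, Nat.find_spec hex⟩
  · rcases Nat.eq_zero_or_pos (Nat.find hex) with h0 | h0
    · have := Nat.find_spec hex
      rw [h0] at this
      simp [ha] at this
    · omega
  · have := Nat.find_min hex (m := (x - a).toNat) (by omega)
    rw [not_not] at this
    rwa [show a + ((x - a).toNat : ℤ) = x by omega] at this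

lemma exists_run_down (p : ℤ → Prop) {a B : ℤ} (ha : p a) (hB : ∀ x, p x → B < x) :
    ∃ b, b < a ∧ (∀ x, b < x → x ≤ a → p x) ∧ ¬ p b := by
  obtain ⟨b, h1, h2, h3⟩ := exists_run_up (fun x => p (-x)) (a := -a) (B := -B) (by simpa using ha)
    (fun x hx => by have := hB _ hx; omega)
  refine ⟨-b, by omega, fun x hx hx' => ?_, h3⟩
  simpa using h2 (-x) (by omega) (by omega)

/-- A maximal run of points with property `p` around `a`. -/
lemma exists_run (p : ℤ → Prop) {a A B : ℤ} (ha : p a) (hB : ∀ x, p x → A < x ∧ x < B) :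
    ∃ b c, b < a ∧ a < c ∧ (∀ x, b < x → x < c → p x) ∧ ¬ p b ∧ ¬ p c := by
  obtain ⟨c, h1, h2, h3⟩ := exists_run_up p ha (fun x hx => (hB x hx).2)
  obtain ⟨b, h4, h5, h6⟩ := exists_run_down p ha (fun x hx => (hB x hx).1)
  refine ⟨b, c, h4, h1, fun x hx hx' => ?_, h6, h3⟩
  rcases le_total a x with h | h
  · exact h2 x h hx'
  · exact h5 x hx h

/-- If two vertically adjacent points are in `S`, then membership in `S` agrees at the two
points next to them. -/
lemma IsPerfectConfig.row_iff (h : IsPerfectConfig M N S) {x x' y y' : ℤ}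
    (hx : x' = x + 1 ∨ x' = x - 1) (hy : y' = y + 1 ∨ y' = y - 1)
    (h1 : S x y) (h2 : S x y') : S x' y ↔ S x' y' := by
  constructor <;> intro h3
  · exact h.square (x' := x) (y' := y) (by omega) (by omega) h3 h2
  · exact h.square (x' := x) (y' := y') (by omega) (by omega) h3 h1

/-- Induction in both directions from a point of an open interval of integers to its closure. -/
lemma int_induction_interval {p : ℤ → Prop} {a b c : ℤ} (h0 : p a)
    (hup : ∀ x, b < x → x < c → a ≤ x → p x → p (x + 1))
    (hdown : ∀ x, b < x → x < c → x ≤ a → p x → p (x - 1)) (hb : b < a) (hc : a < c) :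
    ∀ x, b ≤ x → x ≤ c → p x := by
  have hu : ∀ k : ℕ, a + k ≤ c → p (a + k) := by
    intro k
    induction k with
    | zero => simpa using fun _ => h0
    | succ k ih =>
      intro hk
      push_cast at hk ⊢
      rw [← add_assoc]
      exact hup _ (by omega) (by omega) (by omega) (ih (by omega))
  have hd : ∀ k : ℕ, b ≤ a - k → p (a - k) := by
    intro k
    induction k with
    | zero => simpa using fun _ => h0
    | succ k ih =>
      intro hk
      push_cast at hk ⊢
      rw [← sub_sub]
      exact hdown _ (by omega) (by omega) (by omega) (ih (by omega))
  intro x h1 h2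
  rcases le_total a x with h | h
  · have := hu (x - a).toNat (by omega)
    rwa [show a + ((x - a).toNat : ℤ) = x by omega] at this
  · have := hd (a - x).toNat (by omega)
    rwa [show a - ((a - x).toNat : ℤ) = x by omega] at this

/-- Every member of `S` lies in the interior of a room. -/
lemma IsPerfectConfig.exists_room_of_mem (h : IsPerfectConfig M N S) {x y : ℤ} (hS : S x y) :
    ∃ R, IsRoomRect M N S R ∧ R.x₁ < x ∧ x < R.x₂ ∧ R.y₁ < y ∧ y < R.y₂ := by
  -- The room is spanned by the maximal horizontal and vertical runs of `S` through the given point.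
  obtain ⟨x₁, x₂, hx1, hx2, hx, hxl, hxr⟩ := exists_run (fun t => S t y) (A := 0) (B := M) hS
    (fun t ht => by have := h.inside _ _ ht; omega)
  obtain ⟨y₁, y₂, hy1, hy2, hy, hyl, hyr⟩ := exists_run (fun t => S x t) (A := 0) (B := N) hS
    (fun t ht => by have := h.inside _ _ ht; omega)
  -- All rows of the vertical run agree with row `y` on the closed interval `[x₁, x₂]`. This is an
  -- induction outwards from row `y` and, within each row, outwards from column `x`; the end columns
  -- are included so that the left and right sides are seen to miss `S`.
  have key : ∀ t, y₁ < t → t < y₂ → ∀ z, x₁ ≤ z → z ≤ x₂ → (S z t ↔ S z y) := by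
    intro t ht1 ht2
    have := int_induction_interval (p := fun t => y₁ < t → t < y₂ →
      ∀ z, x₁ ≤ z → z ≤ x₂ → (S z t ↔ S z y)) (a := y) (b := y₁) (c := y₂) (by simp) ?_ ?_ hy1 hy2
      t (by omega) (by omega) ht1 ht2
    · exact this
    · intro t h1 h2 h3 ih h4 h5
      refine int_induction_interval (a := x) ?_ ?_ ?_ hx1 hx2
      · simp [hS, hy _ h4 h5]
      · intro z a b c hz
        have e1 := (ih h1 h2 z (by omega) (by omega)).2 (hx z a b)
        have e2 := hz.2 (hx z a b)
        rw [← ih h1 h2 (z + 1) (by omega) (by omega)]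
        exact (h.row_iff (x := z) (y := t) (Or.inl rfl) (Or.inl rfl) e1 e2).symm
      · intro z a b c hz
        have e1 := (ih h1 h2 z (by omega) (by omega)).2 (hx z a b)
        have e2 := hz.2 (hx z a b)
        rw [← ih h1 h2 (z - 1) (by omega) (by omega)]
        exact (h.row_iff (x := z) (y := t) (Or.inr rfl) (Or.inl rfl) e1 e2).symm
    · intro t h1 h2 h3 ih h4 h5
      refine int_induction_interval (a := x) ?_ ?_ ?_ hx1 hx2
      · simp [hS, hy _ h4 h5]
      · intro z a b c hz
        have e1 := (ih h1 h2 z (by omega) (by omega)).2 (hx z a b)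
        have e2 := hz.2 (hx z a b)
        rw [← ih h1 h2 (z + 1) (by omega) (by omega)]
        exact (h.row_iff (x := z) (y := t) (Or.inl rfl) (Or.inr rfl) e1 e2).symm
      · intro z a b c hz
        have e1 := (ih h1 h2 z (by omega) (by omega)).2 (hx z a b)
        have e2 := hz.2 (hx z a b)
        rw [← ih h1 h2 (z - 1) (by omega) (by omega)]
        exact (h.row_iff (x := z) (y := t) (Or.inr rfl) (Or.inr rfl) e1 e2).symm
  have inner : ∀ z t, x₁ < z → z < x₂ → y₁ < t → t < y₂ → S z t := fun z t a b c d =>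
    (key t c d z a.le b.le).2 (hx z a b)
  -- A row next to the room misses `S` at column `x`. An element of `S` in that row beside a point
  -- outside `S` would form, with the adjacent row of the room, a cell excluded by `square`.
  have hrow : ∀ t, ¬ S x t → (∃ t', (t' = t + 1 ∨ t' = t - 1) ∧ y₁ < t' ∧ t' < y₂) →
      ∀ z, x₁ < z → z < x₂ → ¬ S z t := by
    rintro t hxt ⟨t', ht', hl, hr⟩ z h1 h2
    refine int_induction_interval (p := fun z => x₁ < z → z < x₂ → ¬ S z t) (a := x)
      (fun _ _ => hxt) ?_ ?_ hx1 hx2 z h1.le h2.le h1 h2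
    · intro z a b c hz a' b' hS'
      exact hz a b (h.square (x' := z + 1) (y' := t') (Or.inl rfl) ht' (inner _ _ a b hl hr) hS')
    · intro z a b c hz a' b' hS'
      exact hz a b (h.square (x' := z - 1) (y' := t') (Or.inr rfl) ht' (inner _ _ a b hl hr) hS')
  have e1 := hrow y₁ hyl ⟨y₁ + 1, by omega, by omega, by omega⟩
  have e2 := hrow y₂ hyr ⟨y₂ - 1, by omega, by omega, by omega⟩
  have e3 : ∀ t, y₁ < t → t < y₂ → ¬ S x₁ t := fun t a b =>
    mt (key t a b x₁ le_rfl (by omega)).1 hxl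
  have e4 : ∀ t, y₁ < t → t < y₂ → ¬ S x₂ t := fun t a b =>
    mt (key t a b x₂ (by omega) le_rfl).1 hxr
  -- A corner in `S` would be diagonally opposite to an interior point of the room, and `square`
  -- would put a point of the top or bottom side into `S`.
  have c1 : ¬ S x₁ y₁ := fun hc => e1 (x₁ + 1) (by omega) (by omega)
    (h.square (x' := x₁) (y' := y₁ + 1) (by omega) (by omega)
      (inner _ _ (by omega) (by omega) (by omega) (by omega)) hc)
  have c2 : ¬ S x₁ y₂ := fun hc => e2 (x₁ + 1) (by omega) (by omega)
    (h.square (x' := x₁) (y' := y₂ - 1) (by omega) (by omega)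
      (inner _ _ (by omega) (by omega) (by omega) (by omega)) hc)
  have c3 : ¬ S x₂ y₁ := fun hc => e1 (x₂ - 1) (by omega) (by omega)
    (h.square (x' := x₂) (y' := y₁ + 1) (by omega) (by omega)
      (inner _ _ (by omega) (by omega) (by omega) (by omega)) hc)
  have c4 : ¬ S x₂ y₂ := fun hc => e2 (x₂ - 1) (by omega) (by omega)
    (h.square (x' := x₂) (y' := y₂ - 1) (by omega) (by omega)
      (inner _ _ (by omega) (by omega) (by omega) (by omega)) hc)
  have i1 := h.inside _ _ (inner (x₁ + 1) (y₁ + 1) (by omega) (by omega) (by omega) (by omega))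
  have i2 := h.inside _ _ (inner (x₂ - 1) (y₂ - 1) (by omega) (by omega) (by omega) (by omega))
  refine ⟨⟨x₁, x₂, y₁, y₂⟩, ⟨by dsimp; omega, by dsimp; omega, by dsimp; omega, by dsimp; omega,
    by dsimp; omega, by dsimp; omega, inner, ?_⟩, hx1, hx2, hy1, hy2⟩
  dsimp only
  intro z t a b c d e
  rcases eq_or_lt_of_le a with rfl | a
  · rcases eq_or_lt_of_le c with rfl | c
    · exact c1
    · rcases eq_or_lt_of_le d with rfl | d
      · exact c2
      · exact e3 t c d
  · rcases eq_or_lt_of_le b with rfl | b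
    · rcases eq_or_lt_of_le c with rfl | c
      · exact c3
      · rcases eq_or_lt_of_le d with rfl | d
        · exact c4
        · exact e4 t c d
    · rcases e with rfl | rfl | rfl | rfl
      · omega
      · omega
      · exact e1 z a b
      · exact e2 z a b

/-- Every cell that is not bad lies in a room. -/
lemma IsPerfectConfig.exists_room (h : IsPerfectConfig M N S) {x y : ℤ} (hx : 0 ≤ x) (hx' : x < M)
    (hy : 0 ≤ y) (hy' : y < N) (hb : ¬ BadCell M N S x y) :
    ∃ R, IsRoomRect M N S R ∧ R.HasCell x y := by
  obtain ⟨p, q, hS, hp, hq⟩ : ∃ p q, S p q ∧ (p = x ∨ p = x + 1) ∧ (q = y ∨ q = y + 1) := by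
    by_contra hc
    push Not at hc
    exact hb ⟨hx, hx', hy, hy', fun hS => (hc _ _ hS (by simp)).1 rfl,
      fun hS => (hc _ _ hS (by simp)).1 rfl, fun hS => (hc _ _ hS (by simp)).2 rfl,
      fun hS => (hc _ _ hS (by simp)).2 rfl⟩
  obtain ⟨R, hR, a, b, c, d⟩ := h.exists_room_of_mem hS
  exact ⟨R, hR, by omega, by omega, by omega, by omega⟩

/-! ### Ladders around the bad cells -/

/-- Two bad cells that are adjacent along a side have no bad cell next to them off their line. -/
lemma IsPerfectConfig.not_tromino (h : IsPerfectConfig M N S) {x x' y y' : ℤ}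
    (hx : x' = x + 1 ∨ x' = x - 1) (hy : y' = y + 1 ∨ y' = y - 1) (h1 : BadCell M N S x y)
    (h2 : BadCell M N S x' y) : ¬ BadCell M N S x y' := by
  intro h3
  obtain ⟨a1, a2, a3, a4, a5, a6, a7, a8⟩ := h1
  obtain ⟨b1, b2, b3, b4, b5, b6, b7, b8⟩ := h2
  obtain ⟨c1, c2, c3, c4, c5, c6, c7, c8⟩ := h3
  -- The vertex common to the three cells is interior, and it and its four neighbours are corners of
  -- these cells, so nothing dominates it.
  rcases hx with rfl | rfl <;> rcases hy with rfl | rfl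
  · have := h.dominated (x + 1) (y + 1) (by omega) (by omega) (by omega) (by omega) a8
    simp only [add_sub_cancel_right] at this
    tauto
  · have := h.dominated (x + 1) y (by omega) (by omega) (by omega) (by omega) a6
    simp only [add_sub_cancel_right] at this
    tauto
  · have := h.dominated x (y + 1) (by omega) (by omega) (by omega) (by omega) a7
    simp only [add_sub_cancel_right] at this
    tauto
  · have := h.dominated x y (by omega) (by omega) (by omega) (by omega) a5
    tauto

/-- A bad cell with a bad horizontal neighbour or without bad vertical neighbours lies in a
ladder. -/
lemma IsPerfectConfig.exists_horizontal_ladder (h : IsPerfectConfig M N S) {x y : ℤ}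
    (hb : BadCell M N S x y) (hn : (BadCell M N S (x - 1) y ∨ BadCell M N S (x + 1) y) ∨
      (¬ BadCell M N S x (y - 1) ∧ ¬ BadCell M N S x (y + 1))) :
    ∃ L, IsLadderRect M N S L ∧ L.HasCell x y := by
  obtain ⟨x₁, x₂, hx1, hx2, hx, hxl, hxr⟩ := exists_run (fun t => BadCell M N S t y)
    (A := -1) (B := M) hb (fun t ht => by obtain ⟨a, b, -⟩ := ht; omega)
  -- In a run of at least two cells every cell has a bad horizontal neighbour and `not_tromino`
  -- applies. A run of one cell leaves only the second alternative of `hn`.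
  have hv : ∀ z, x₁ < z → z < x₂ → ∀ t, (t = y + 1 ∨ t = y - 1) → ¬ BadCell M N S z t := by
    intro z h1 h2 t ht
    by_cases hz : x₁ < z - 1
    · exact h.not_tromino (Or.inr rfl) ht (hx z h1 h2) (hx _ hz (by omega))
    · by_cases hz' : z + 1 < x₂
      · exact h.not_tromino (Or.inl rfl) ht (hx z h1 h2) (hx _ (by omega) hz')
      · obtain rfl : z = x := by omega
        obtain rfl : x₁ = z - 1 := by omega
        obtain rfl : x₂ = z + 1 := by omega
        rcases ht with rfl | rfl <;> tauto
  refine ⟨⟨x₁ + 1, x₂, y, y + 1⟩, ⟨by dsimp; omega, by dsimp; omega, ?_, ?_, ?_, ?_, ?_⟩,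
    by simp only; omega, hx2, le_rfl, by simp⟩ <;> dsimp only
  · intro z t a b c d
    obtain rfl : t = y := by omega
    exact hx z (by omega) b
  · intro t a b
    obtain rfl : t = y := by omega
    simpa using hxl
  · intro t a b
    obtain rfl : t = y := by omega
    exact hxr
  · exact fun z a b => hv z (by omega) b _ (Or.inr rfl)
  · exact fun z a b => hv z (by omega) b _ (Or.inl rfl)

lemma IsPerfectConfig.exists_ladder (h : IsPerfectConfig M N S) {x y : ℤ}
    (hb : BadCell M N S x y) : ∃ L, IsLadderRect M N S L ∧ L.HasCell x y := by
  by_cases hn : (BadCell M N S (x - 1) y ∨ BadCell M N S (x + 1) y) ∨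
      (¬ BadCell M N S x (y - 1) ∧ ¬ BadCell M N S x (y + 1))
  · exact h.exists_horizontal_ladder hb hn
  · obtain ⟨L, hL, hc⟩ := h.swap.exists_horizontal_ladder (x := y) (y := x) (badCell_swap.2 hb)
      (by simp only [badCell_swap]; tauto)
    exact ⟨L.swap, isLadderRect_swap.1 hL, hc.2.2.1, hc.2.2.2, hc.1, hc.2.1⟩

/-- A rectangle with both sides at least two contains three cells in the shape of an L. -/
lemma IsLadderRect.thin (h : IsPerfectConfig M N S) {L : IntRect} (hL : IsLadderRect M N S L) :
    L.x₂ = L.x₁ + 1 ∨ L.y₂ = L.y₁ + 1 := by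
  have := hL.width
  have := hL.height
  by_contra hc
  exact h.not_tromino (x := L.x₁) (y := L.y₁) (Or.inl rfl) (Or.inl rfl)
    (hL.bad _ _ (by omega) (by omega) (by omega) (by omega))
    (hL.bad _ _ (by omega) (by omega) (by omega) (by omega))
    (hL.bad _ _ (by omega) (by omega) (by omega) (by omega))

/-! ### Contacts of rooms and ladders at the right side of a room -/

/-- The cells at the right side of a room, other than the extreme ones, are bad. -/
lemma IsRoomRect.badCell_right (h : IsPerfectConfig M N S) {R : IntRect}
    (hR : IsRoomRect M N S R) (hM : R.x₂ < M) {y : ℤ} (h1 : R.y₁ ≤ y) (h2 : y < R.y₂)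
    (ht : R.y₁ = y → ¬ S (R.x₂ + 1) y) (hb : y + 1 = R.y₂ → ¬ S (R.x₂ + 1) (y + 1)) :
    BadCell M N S R.x₂ y := by
  have hw := hR.width
  have hl := hR.left
  have htop := hR.top
  have hbot := hR.bottom
  have hmid : ∀ t, R.y₁ < t → t < R.y₂ → ¬ S (R.x₂ + 1) t := fun t a b hS =>
    h.horizontal R.x₂ t (hR.outer _ _ (by omega) le_rfl a.le b.le (by simp))
      ⟨hR.inner _ _ (by omega) (by omega) a b, hS⟩
  refine ⟨by omega, hM, by omega, by omega, ?_, ?_, ?_, ?_⟩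
  · exact hR.outer _ _ (by omega) (by omega) (by omega) (by omega) (by simp)
  · rcases eq_or_lt_of_le h1 with e | e
    · exact ht e
    · exact hmid y e h2
  · exact hR.outer _ _ (by omega) (by omega) (by omega) (by omega) (by simp)
  · by_cases e : y + 1 = R.y₂
    · exact hb e
    · exact hmid (y + 1) (by omega) (by omega)

/-- A side of length at least three has a non-extreme cell. On a side of length two, an element of
`S` spoiling the upper cell excludes one spoiling the lower cell, since otherwise the point halfway
between them would have two vertical neighbours in `S`. -/
lemma IsRoomRect.exists_right_ladder (h : IsPerfectConfig M N S) {R : IntRect}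
    (hR : IsRoomRect M N S R) (hM : R.x₂ < M) : ∃ L, IsLadderRect M N S L ∧ R.RightOf L := by
  have hw := hR.width
  have hh := hR.height
  obtain ⟨y, h1, h2, hb⟩ : ∃ y, R.y₁ ≤ y ∧ y < R.y₂ ∧ BadCell M N S R.x₂ y := by
    by_cases h3 : R.y₁ + 3 ≤ R.y₂
    · exact ⟨R.y₁ + 1, by omega, by omega, hR.badCell_right h hM (by omega) (by omega)
        (by omega) (by omega)⟩
    · by_cases hS : S (R.x₂ + 1) R.y₁
      · refine ⟨R.y₁ + 1, by omega, by omega, hR.badCell_right h hM (by omega) (by omega)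
          (by omega) fun _ hS' => ?_⟩
        refine h.vertical (R.x₂ + 1) (R.y₁ + 1) (fun hS'' => ?_) ⟨by simpa using hS, hS'⟩
        exact h.horizontal R.x₂ (R.y₁ + 1)
          (hR.outer _ _ (by omega) (by omega) (by omega) (by omega) (by simp))
          ⟨hR.inner _ _ (by omega) (by omega) (by omega) (by omega), hS''⟩
      · exact ⟨R.y₁, by omega, by omega, hR.badCell_right h hM (by omega) (by omega)
          (fun _ => hS) (by omega)⟩
  obtain ⟨L, hL, a, b, c, d⟩ := h.exists_ladder hb
  refine ⟨L, hL, ?_, by omega, by omega⟩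
  by_contra hne
  exact hR.not_badCell (x := R.x₂ - 1) (y := y) ⟨by omega, by omega, h1, h2⟩
    (hL.bad _ _ (by omega) (by omega) c d)

/-- The side of a ladder at a room is a part of the side of the room, shorter by at most one at
either end. -/
lemma IsRoomRect.right_ladder_bounds (h : IsPerfectConfig M N S) {R L : IntRect}
    (hR : IsRoomRect M N S R) (hL : IsLadderRect M N S L) (hRL : R.RightOf L) :
    R.y₁ ≤ L.y₁ ∧ L.y₁ ≤ R.y₁ + 1 ∧ R.y₂ - 1 ≤ L.y₂ ∧ L.y₂ ≤ R.y₂ ∧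
      (R.y₁ = 0 → L.y₁ = 0) ∧ (R.y₂ = N → L.y₂ = N) := by
  obtain ⟨e, h1, h2⟩ := hRL
  have hw := hR.width
  have hh := hR.height
  have hl := hR.left
  have ht := hR.top
  have hb := hR.bottom
  have hLw := hL.width
  have hLh := hL.height
  have hB := hL.bounds
  have m : ∀ y, R.y₁ ≤ y → y ≤ R.y₂ → ¬ S R.x₂ y := fun y a b =>
    hR.outer _ _ (by omega) le_rfl a b (by simp)
  -- If the ladder went past the corner of the room, that corner would be undominated: one neighbour
  -- is on the boundary of the room, the others are corners of bad cells.
  have p1 : R.y₁ ≤ L.y₁ := by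
    by_contra hc
    obtain ⟨-, -, -, -, a1, a2, a3, a4⟩ := hL.bad R.x₂ R.y₁ (by omega) (by omega) (by omega)
      (by omega)
    obtain ⟨-, -, -, -, b1, b2, b3, b4⟩ := hL.bad R.x₂ (R.y₁ - 1) (by omega) (by omega) (by omega)
      (by omega)
    rcases h.dominated R.x₂ R.y₁ (by omega) (by omega) (by omega) (by omega) a1 with s | s | s | s
    · exact hR.outer _ _ (by omega) (by omega) (by omega) (by omega) (by simp) s
    · exact a2 s
    · exact b1 s
    · exact a3 s
  have p2 : L.y₂ ≤ R.y₂ := by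
    by_contra hc
    obtain ⟨-, -, -, -, a1, a2, a3, a4⟩ := hL.bad R.x₂ R.y₂ (by omega) (by omega) (by omega)
      (by omega)
    obtain ⟨-, -, -, -, b1, b2, b3, b4⟩ := hL.bad R.x₂ (R.y₂ - 1) (by omega) (by omega) (by omega)
      (by omega)
    rcases h.dominated R.x₂ R.y₂ (by omega) (by omega) (by omega) (by omega) a1 with s | s | s | s
    · exact hR.outer _ _ (by omega) (by omega) (by omega) (by omega) (by simp) s
    · exact a2 s
    · exact b1 s
    · exact a3 s
  refine ⟨p1, ?_, ?_, p2, ?_, ?_⟩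
  · by_contra hc
    refine hL.top R.x₂ (by omega) (by omega) (hR.badCell_right h (by omega) (by omega) (by omega)
      (by omega) (by omega))
  · by_contra hc
    refine hL.bottom R.x₂ (by omega) (by omega) (hR.badCell_right h (by omega) (by omega)
      (by omega) (by omega) (by omega))
  -- On the border of the region the extreme cell is bad as well, since the point that could spoil
  -- it is not interior.
  · intro h0
    by_contra hc
    refine hL.top R.x₂ (by omega) (by omega) (hR.badCell_right h (by omega) (by omega) (by omega)
      (fun e hS => ?_) (by omega))
    have := h.inside _ _ hS
    omega
  · intro h0
    by_contra hc
    refine hL.bottom R.x₂ (by omega) (by omega) (hR.badCell_right h (by omega) (by omega) (by omega)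
      (by omega) (fun e hS => ?_))
    have := h.inside _ _ hS
    omega

lemma IsRoomRect.right_ladder_unique (h : IsPerfectConfig M N S) {R L L' : IntRect}
    (hR : IsRoomRect M N S R) (hL : IsLadderRect M N S L) (hL' : IsLadderRect M N S L')
    (hRL : R.RightOf L) (hRL' : R.RightOf L') : L = L' := by
  have b1 := hR.right_ladder_bounds h hL hRL
  have b2 := hR.right_ladder_bounds h hL' hRL'
  obtain ⟨e, -⟩ := hRL
  obtain ⟨e', -⟩ := hRL'
  have hh := hR.height
  have c1 := hL.bounds
  have c2 := hL'.bounds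
  -- Each ladder misses at most one cell at either end of the side. Disjoint ones are possible only
  -- on a side of length two; they would then be consecutive, against the maximality of the upper
  -- one.
  by_cases k1 : L'.y₁ < L.y₂
  · by_cases k2 : L.y₁ < L'.y₂
    · rcases le_total L.y₁ L'.y₁ with k | k
      · exact hL.eq_of_hasCell hL' (x := R.x₂) (y := L'.y₁)
          ⟨by omega, by omega, by omega, by omega⟩ ⟨by omega, by omega, by omega, by omega⟩
      · exact hL.eq_of_hasCell hL' (x := R.x₂) (y := L.y₁)
          ⟨by omega, by omega, by omega, by omega⟩ ⟨by omega, by omega, by omega, by omega⟩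
    · exact absurd (hL.bad R.x₂ L'.y₂ (by omega) (by omega) (by omega) (by omega))
        (hL'.bottom R.x₂ (by omega) (by omega))
  · exact absurd (hL'.bad R.x₂ L.y₂ (by omega) (by omega) (by omega) (by omega))
      (hL.bottom R.x₂ (by omega) (by omega))

lemma IsLadderRect.exists_right_room (h : IsPerfectConfig M N S) {L : IntRect}
    (hL : IsLadderRect M N S L) (hM : L.x₂ < M) : ∃ R, IsRoomRect M N S R ∧ L.RightOf R := by
  have hB := hL.bounds
  obtain ⟨R, hR, a, b, c, d⟩ := h.exists_room (x := L.x₂) (y := L.y₁) (by omega) hM (by omega)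
    (by omega) (hL.right _ le_rfl (by omega))
  refine ⟨R, hR, ?_, by omega, by omega⟩
  by_contra hne
  exact hR.not_badCell (x := L.x₂ - 1) (y := L.y₁) ⟨by omega, by omega, by omega, by omega⟩
    (hL.bad _ _ (by omega) (by omega) le_rfl (by omega))

/-- The side of the ladder is contained in the side of either room, so both rooms contain the cell
to the left of the ladder's first cell. -/
lemma IsLadderRect.left_room_unique (h : IsPerfectConfig M N S) {R R' L : IntRect}
    (hL : IsLadderRect M N S L) (hR : IsRoomRect M N S R) (hR' : IsRoomRect M N S R')
    (hRL : R.RightOf L) (hRL' : R'.RightOf L) : R = R' := by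
  have b1 := hR.right_ladder_bounds h hL hRL
  have b2 := hR'.right_ladder_bounds h hL hRL'
  have w1 := hR.width
  have w2 := hR'.width
  have hh := hL.height
  obtain ⟨e, -⟩ := hRL
  obtain ⟨e', -⟩ := hRL'
  exact hR.eq_of_hasCell hR' (x := L.x₁ - 1) (y := L.y₁)
    ⟨by omega, by omega, by omega, by omega⟩ ⟨by omega, by omega, by omega, by omega⟩

end Local

/-! ### Steps between neighbouring tiles -/

/-- A room or a ladder. -/
def IsTile (M N : ℤ) (S : ℤ → ℤ → Prop) (R : IntRect) : Prop :=
  IsRoomRect M N S R ∨ IsLadderRect M N S R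

/-- `R'` is a ladder at the right side of the room `R` or a room at the right side of the
ladder `R`. -/
def StepRight (M N : ℤ) (S : ℤ → ℤ → Prop) (R R' : IntRect) : Prop :=
  R.RightOf R' ∧ (IsRoomRect M N S R ∧ IsLadderRect M N S R' ∨
    IsLadderRect M N S R ∧ IsRoomRect M N S R')

/-- `R'` is a ladder at the lower side of the room `R` or a room at the lower side of the
ladder `R`. -/
def StepDown (M N : ℤ) (S : ℤ → ℤ → Prop) (R R' : IntRect) : Prop :=
  StepRight N M (fun x y => S y x) R.swap R'.swap

section Tiles

variable {M N : ℤ} {S : ℤ → ℤ → Prop}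

lemma IsRoomRect.not_isLadderRect {R : IntRect} (h : IsRoomRect M N S R) :
    ¬ IsLadderRect M N S R := fun h' => by
  have h1 := h.width
  have h2 := h.height
  have hc : R.HasCell R.x₁ R.y₁ := ⟨by omega, by omega, by omega, by omega⟩
  exact h.not_badCell hc (h'.badCell_of_hasCell hc)

lemma isTile_flip {R : IntRect} :
    IsTile M N (fun x y => S (M - x) y) (R.flip M) ↔ IsTile M N S R :=
  or_congr isRoomRect_flip isLadderRect_flip

lemma isTile_swap {R : IntRect} : IsTile N M (fun x y => S y x) R.swap ↔ IsTile M N S R :=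
  or_congr isRoomRect_swap isLadderRect_swap

lemma rightOf_flip {R R' : IntRect} : (R'.flip M).RightOf (R.flip M) ↔ R.RightOf R' := by
  simp only [IntRect.RightOf, IntRect.flip]
  omega

lemma stepRight_flip {R R' : IntRect} :
    StepRight M N (fun x y => S (M - x) y) (R'.flip M) (R.flip M) ↔ StepRight M N S R R' := by
  unfold StepRight
  rw [rightOf_flip, isRoomRect_flip, isRoomRect_flip, isLadderRect_flip, isLadderRect_flip]
  tauto

lemma stepDown_flip {R R' : IntRect} :
    StepDown M N (fun x y => S (M - x) y) (R.flip M) (R'.flip M) ↔ StepDown M N S R R' := by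
  unfold StepDown StepRight
  rw [isRoomRect_swap (S := fun x y => S (M - x) y), isRoomRect_swap (S := fun x y => S (M - x) y),
    isLadderRect_swap (S := fun x y => S (M - x) y),
    isLadderRect_swap (S := fun x y => S (M - x) y), isRoomRect_flip, isRoomRect_flip,
    isLadderRect_flip, isLadderRect_flip, isRoomRect_swap, isRoomRect_swap, isLadderRect_swap,
    isLadderRect_swap]
  refine and_congr ?_ Iff.rfl
  simp only [IntRect.RightOf, IntRect.flip, IntRect.swap]
  omega

lemma IsTile.bounds {R : IntRect} (h : IsTile M N S R) :
    0 ≤ R.x₁ ∧ R.x₁ < R.x₂ ∧ R.x₂ ≤ M ∧ 0 ≤ R.y₁ ∧ R.y₁ < R.y₂ ∧ R.y₂ ≤ N := by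
  rcases h with h | h
  · have := h.width; have := h.height; have := h.left; have := h.right; have := h.top
    have := h.bottom
    omega
  · exact h.bounds

lemma IsTile.eq_of_hasCell {R R' : IntRect} (h : IsTile M N S R) (h' : IsTile M N S R') {x y : ℤ}
    (hc : R.HasCell x y) (hc' : R'.HasCell x y) : R = R' := by
  rcases h with h | h <;> rcases h' with h' | h'
  · exact h.eq_of_hasCell h' hc hc'
  · exact absurd (h'.badCell_of_hasCell hc') (h.not_badCell hc)
  · exact absurd (h.badCell_of_hasCell hc) (h'.not_badCell hc')
  · exact h.eq_of_hasCell h' hc hc'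

lemma IsPerfectConfig.exists_tile (h : IsPerfectConfig M N S) {x y : ℤ} (hx : 0 ≤ x) (hx' : x < M)
    (hy : 0 ≤ y) (hy' : y < N) : ∃ R, IsTile M N S R ∧ R.HasCell x y := by
  by_cases hb : BadCell M N S x y
  · obtain ⟨R, hR, hc⟩ := h.exists_ladder hb
    exact ⟨R, Or.inr hR, hc⟩
  · obtain ⟨R, hR, hc⟩ := h.exists_room hx hx' hy hy' hb
    exact ⟨R, Or.inl hR, hc⟩

lemma StepRight.tile_left {R R' : IntRect} (h : StepRight M N S R R') : IsTile M N S R :=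
  h.2.imp And.left And.left

lemma StepRight.tile_right {R R' : IntRect} (h : StepRight M N S R R') : IsTile M N S R' :=
  (h.2.imp And.right And.right).symm

lemma StepDown.tile_left {R R' : IntRect} (h : StepDown M N S R R') : IsTile M N S R :=
  isTile_swap.1 (StepRight.tile_left h)

lemma StepDown.tile_right {R R' : IntRect} (h : StepDown M N S R R') : IsTile M N S R' :=
  isTile_swap.1 (StepRight.tile_right h)

lemma StepRight.x_eq {R R' : IntRect} (h : StepRight M N S R R') : R'.x₁ = R.x₂ := h.1.1

lemma StepDown.y_eq {R R' : IntRect} (h : StepDown M N S R R') : R'.y₁ = R.y₂ := h.1.1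

lemma IsPerfectConfig.exists_stepRight (h : IsPerfectConfig M N S) {R : IntRect}
    (hR : IsTile M N S R) (hM : R.x₂ < M) : ∃ R', StepRight M N S R R' := by
  rcases hR with hR | hR
  · obtain ⟨L, hL, hRL⟩ := hR.exists_right_ladder h hM
    exact ⟨L, hRL, Or.inl ⟨hR, hL⟩⟩
  · obtain ⟨L, hL, hRL⟩ := hR.exists_right_room h hM
    exact ⟨L, hRL, Or.inr ⟨hR, hL⟩⟩

lemma IsPerfectConfig.exists_stepLeft (h : IsPerfectConfig M N S) {R : IntRect}
    (hR : IsTile M N S R) (h0 : 0 < R.x₁) : ∃ R', StepRight M N S R' R := by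
  obtain ⟨R', hR'⟩ := h.flip.exists_stepRight (isTile_flip.2 hR)
    (by simp only [IntRect.flip]; omega)
  refine ⟨R'.flip M, stepRight_flip.1 ?_⟩
  rwa [IntRect.flip_flip]

lemma IsPerfectConfig.exists_stepDown (h : IsPerfectConfig M N S) {R : IntRect}
    (hR : IsTile M N S R) (hN : R.y₂ < N) : ∃ R', StepDown M N S R R' := by
  obtain ⟨R', hR'⟩ := h.swap.exists_stepRight (isTile_swap.2 hR) hN
  exact ⟨R'.swap, hR'⟩

lemma IsPerfectConfig.exists_stepUp (h : IsPerfectConfig M N S) {R : IntRect}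
    (hR : IsTile M N S R) (h0 : 0 < R.y₁) : ∃ R', StepDown M N S R' R := by
  obtain ⟨R', hR'⟩ := h.swap.exists_stepLeft (isTile_swap.2 hR) h0
  exact ⟨R'.swap, hR'⟩

lemma StepRight.unique_of_room (h : IsPerfectConfig M N S) {R R' R'' : IntRect}
    (hR : IsRoomRect M N S R) (h1 : StepRight M N S R R') (h2 : StepRight M N S R R'') :
    R' = R'' := by
  have hn := hR.not_isLadderRect
  obtain ⟨h1, ⟨-, h1'⟩ | ⟨h1', -⟩⟩ := h1
  · obtain ⟨h2, ⟨-, h2'⟩ | ⟨h2', -⟩⟩ := h2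
    · exact hR.right_ladder_unique h h1' h2' h1 h2
    · exact absurd h2' hn
  · exact absurd h1' hn

lemma StepRight.unique_left_of_ladder (h : IsPerfectConfig M N S) {R R' R'' : IntRect}
    (hR : IsLadderRect M N S R) (h1 : StepRight M N S R' R) (h2 : StepRight M N S R'' R) :
    R' = R'' := by
  have hn : ¬ IsRoomRect M N S R := fun hr => hr.not_isLadderRect hR
  obtain ⟨h1, ⟨h1', -⟩ | ⟨-, h1'⟩⟩ := h1
  · obtain ⟨h2, ⟨h2', -⟩ | ⟨-, h2'⟩⟩ := h2
    · exact hR.left_room_unique h h1' h2' h1 h2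
    · exact absurd h2' hn
  · exact absurd h1' hn

lemma IntRect.flip_injective : Function.Injective (IntRect.flip M) :=
  Function.LeftInverse.injective (IntRect.flip_flip M)

/-- For a room this is uniqueness of the ladder at its side. For a ladder, reflection turns it into
uniqueness of the room on the left. -/
lemma StepRight.unique (h : IsPerfectConfig M N S) {R R' R'' : IntRect}
    (h1 : StepRight M N S R R') (h2 : StepRight M N S R R'') : R' = R'' := by
  rcases h1.tile_left with hR | hR
  · exact unique_of_room h hR h1 h2
  · exact IntRect.flip_injective (unique_left_of_ladder h.flip (isLadderRect_flip.2 hR)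
      (stepRight_flip.2 h1) (stepRight_flip.2 h2))

lemma StepRight.unique_left (h : IsPerfectConfig M N S) {R R' R'' : IntRect}
    (h1 : StepRight M N S R' R) (h2 : StepRight M N S R'' R) : R' = R'' :=
  IntRect.flip_injective (unique h.flip (stepRight_flip.2 h1) (stepRight_flip.2 h2))

lemma StepDown.unique (h : IsPerfectConfig M N S) {R R' R'' : IntRect}
    (h1 : StepDown M N S R R') (h2 : StepDown M N S R R'') : R' = R'' :=
  congrArg IntRect.swap (StepRight.unique h.swap h1 h2)

lemma StepDown.unique_up (h : IsPerfectConfig M N S) {R R' R'' : IntRect}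
    (h1 : StepDown M N S R' R) (h2 : StepDown M N S R'' R) : R' = R'' :=
  congrArg IntRect.swap (StepRight.unique_left h.swap h1 h2)

lemma StepRight.bounds (h : IsPerfectConfig M N S) {R R' : IntRect}
    (h1 : StepRight M N S R R') : |R'.y₁ - R.y₁| ≤ 1 ∧ |R'.y₂ - R.y₂| ≤ 1 ∧
      (R.y₁ = 0 ↔ R'.y₁ = 0) ∧ (R.y₂ = N ↔ R'.y₂ = N) := by
  have b1 := h1.tile_left.bounds
  have b2 := h1.tile_right.bounds
  rw [abs_le, abs_le]
  obtain ⟨h1, ⟨hR, hL⟩ | ⟨hL, hR⟩⟩ := h1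
  · have := hR.right_ladder_bounds h hL h1
    omega
  · have := (isRoomRect_flip.2 hR).right_ladder_bounds h.flip (isLadderRect_flip.2 hL)
      (rightOf_flip.2 h1)
    simp only [IntRect.flip] at this
    omega

lemma StepDown.bounds (h : IsPerfectConfig M N S) {R R' : IntRect}
    (h1 : StepDown M N S R R') : |R'.x₁ - R.x₁| ≤ 1 ∧ |R'.x₂ - R.x₂| ≤ 1 ∧
      (R.x₁ = 0 ↔ R'.x₁ = 0) ∧ (R.x₂ = M ↔ R'.x₂ = M) :=
  StepRight.bounds h.swap h1

/-! ### Corners of rooms and commutation of steps -/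

/-- The lower right corner of a room, if its right neighbour is in `S`. -/
lemma IsRoomRect.corner_of_right_mem (h : IsPerfectConfig M N S) {R A B : IntRect}
    (hR : IsRoomRect M N S R) (hA : IsLadderRect M N S A) (hB : IsLadderRect M N S B)
    (hRA : R.RightOf A) (hRB : R.swap.RightOf B.swap) (hS : S (R.x₂ + 1) R.y₂) :
    ∃ X, IsRoomRect M N S X ∧ B.RightOf X ∧ A.swap.RightOf X.swap := by
  have hw := hR.width
  have hh := hR.height
  have hl := hR.left
  have ht := hR.top
  have bA := hR.right_ladder_bounds h hA hRA
  have bB := (isRoomRect_swap.2 hR).right_ladder_bounds h.swap (isLadderRect_swap.2 hB) hRB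
  have cA := hA.bounds
  have cB := hB.bounds
  obtain ⟨eA, -⟩ := hRA
  obtain ⟨eB, -⟩ := hRB
  simp only [IntRect.swap] at eB bB
  have hp : ¬ S R.x₂ R.y₂ := hR.outer _ _ (by omega) le_rfl (by omega) le_rfl (by simp)
  obtain ⟨X, hX, x1, x2, x3, x4⟩ := h.exists_room_of_mem hS
  -- The room `X` of the dominating element starts on the line of the right side of `R`, as the
  -- corner is not in `S`. It starts one unit above the lower side of `R`, as otherwise the point
  -- above the corner would have two horizontal neighbours in `S`.
  have hX1 : X.x₁ = R.x₂ := by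
    by_contra hne
    exact hp (hX.inner _ _ (by omega) (by omega) x3 x4)
  have hX3 : X.y₁ = R.y₂ - 1 := by
    by_contra hne
    exact h.horizontal R.x₂ (R.y₂ - 1)
      (hR.outer _ _ (by omega) le_rfl (by omega) (by omega) (by simp))
      ⟨hR.inner _ _ (by omega) (by omega) (by omega) (by omega),
        hX.inner _ _ x1 x2 (by omega) (by omega)⟩
  have hA2 : A.y₂ = R.y₂ - 1 := by
    by_contra hne
    have := hA.bad R.x₂ (R.y₂ - 1) (by omega) (by omega) (by omega) (by omega)
    unfold BadCell at this
    rw [sub_add_cancel] at this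
    tauto
  -- The ladder below reaches the corner: a missing last cell could be spoiled only by the point
  -- below the corner, which would dominate the corner a second time.
  have hB2 : B.x₂ = R.x₂ := by
    by_contra hne
    refine hB.right R.y₂ (by omega) (by omega) (badCell_swap.1 ?_)
    refine (isRoomRect_swap.2 hR).badCell_right (y := B.x₂) h.swap ?_ ?_ ?_ ?_ ?_ <;>
      simp only [IntRect.swap]
    · omega
    · omega
    · omega
    · omega
    · intro e hS'
      rw [e] at hS'
      exact h.corner R.x₂ R.y₂ (by omega) (by omega) (by omega) (by omega) hp
        ⟨Or.inr hS, Or.inr hS'⟩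
  refine ⟨X, hX, ⟨by omega, by omega, by omega⟩, ?_, ?_, ?_⟩ <;> simp only [IntRect.swap] <;> omega

/-- The corner is outside `S`, and two of its neighbours are on the boundary of the room. The
element of `S` dominating it is thus to the right or below, and the diagonal reflection exchanges
these cases. -/
lemma IsRoomRect.lower_right_corner (h : IsPerfectConfig M N S) {R A B : IntRect}
    (hR : IsRoomRect M N S R) (hA : StepRight M N S R A) (hB : StepDown M N S R B) :
    ∃ X, StepRight M N S B X ∧ StepDown M N S A X := by
  obtain ⟨hRA, ⟨-, hA⟩ | ⟨hA, -⟩⟩ := hA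
  swap
  · exact absurd hA hR.not_isLadderRect
  obtain ⟨hRB, ⟨-, hB⟩ | ⟨hB, -⟩⟩ := hB
  swap
  · exact absurd (isLadderRect_swap.1 hB) hR.not_isLadderRect
  replace hB := isLadderRect_swap.1 hB
  have hw := hR.width
  have hh := hR.height
  have hl := hR.left
  have ht := hR.top
  have cA := hA.bounds
  have cB := hB.bounds
  have hp : ¬ S R.x₂ R.y₂ := hR.outer _ _ (by omega) le_rfl (by omega) le_rfl (by simp)
  have eA := hRA.1
  have eB := hRB.1
  simp only [IntRect.swap] at eB
  obtain ⟨X, hX, h1, h2⟩ : ∃ X, IsRoomRect M N S X ∧ B.RightOf X ∧ A.swap.RightOf X.swap := by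
    rcases h.dominated R.x₂ R.y₂ (by omega) (by omega) (by omega) (by omega) hp with s | s | s | s
    · exact absurd s (hR.outer _ _ (by omega) (by omega) (by omega) (by omega) (by simp))
    · exact hR.corner_of_right_mem h hA hB hRA hRB s
    · exact absurd s (hR.outer _ _ (by omega) (by omega) (by omega) (by omega) (by simp))
    · obtain ⟨X, hX, h1, h2⟩ := (isRoomRect_swap.2 hR).corner_of_right_mem h.swap
        (isLadderRect_swap.2 hB) (isLadderRect_swap.2 hA) hRB hRA s
      exact ⟨X.swap, isRoomRect_swap.1 hX, h2, h1⟩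
  exact ⟨X, ⟨h1, Or.inr ⟨hB, hX⟩⟩, h2, Or.inr ⟨isLadderRect_swap.2 hA, isRoomRect_swap.2 hX⟩⟩

lemma IsRoomRect.lower_left_corner (h : IsPerfectConfig M N S) {R A B : IntRect}
    (hR : IsRoomRect M N S R) (hA : StepRight M N S A R) (hB : StepDown M N S R B) :
    ∃ X, StepRight M N S X B ∧ StepDown M N S A X := by
  obtain ⟨X, h1, h2⟩ := (isRoomRect_flip.2 hR).lower_right_corner h.flip (stepRight_flip.2 hA)
    (stepDown_flip.2 hB)
  refine ⟨X.flip M, stepRight_flip.1 ?_, stepDown_flip.1 ?_⟩ <;> rwa [IntRect.flip_flip]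

/-- Steps to the right and steps down commute. -/
lemma StepRight.comm_stepDown (h : IsPerfectConfig M N S) {R A B : IntRect}
    (hA : StepRight M N S R A) (hB : StepDown M N S R B) :
    ∃ X, StepRight M N S B X ∧ StepDown M N S A X := by
  rcases hA.2 with ⟨hR, -⟩ | ⟨-, hAr⟩
  · exact hR.lower_right_corner h hA hB
  -- If `R` is a ladder, then `A` is a room. The lower left corner of `A` yields a tile below `R`,
  -- which is `B` by uniqueness.
  · have b := (hA.bounds h).2.2.2
    have b1 := hB.tile_right.bounds
    have b2 := hA.tile_right.bounds
    have e := hB.y_eq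
    obtain ⟨C, hC⟩ := h.exists_stepDown hA.tile_right (by omega)
    obtain ⟨X, h1, h2⟩ := hAr.lower_left_corner h hA hC
    obtain rfl := hB.unique h h2
    exact ⟨C, h1, hC⟩

end Tiles

/-! ### Grids of tiles: existence, completeness, uniqueness -/

/-- `T` arranges tiles in `r` columns and `s` rows by steps to the right and steps down, from the
upper left corner to the right and lower sides of `[0, M] × [0, N]`. -/
structure IsTileGrid (M N : ℤ) (S : ℤ → ℤ → Prop) (r s : ℕ) (T : ℕ → ℕ → IntRect) : Prop where
  r_pos : 0 < r
  s_pos : 0 < s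
  tile : ∀ i j, i < r → j < s → IsTile M N S (T i j)
  right : ∀ i j, i + 1 < r → j < s → StepRight M N S (T i j) (T (i + 1) j)
  down : ∀ i j, i < r → j + 1 < s → StepDown M N S (T i j) (T i (j + 1))
  left_zero : (T 0 0).x₁ = 0
  top_zero : (T 0 0).y₁ = 0
  right_end : (T (r - 1) 0).x₂ = M
  bottom_end : (T 0 (s - 1)).y₂ = N

section Grid

variable {M N : ℤ} {S : ℤ → ℤ → Prop}

lemma IsPerfectConfig.exists_row (h : IsPerfectConfig M N S) {R : IntRect} (hR : IsTile M N S R) :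
    ∃ (u : ℕ → IntRect) (r : ℕ), 0 < r ∧ u 0 = R ∧
      (∀ i, i + 1 < r → StepRight M N S (u i) (u (i + 1))) ∧ (u (r - 1)).x₂ = M := by
  induction hk : (M - R.x₂).toNat using Nat.strong_induction_on generalizing R with
  | _ k ih =>
    have hb := hR.bounds
    by_cases hM : R.x₂ = M
    · exact ⟨fun _ => R, 1, one_pos, rfl, fun i hi => by omega, hM⟩
    · obtain ⟨R', hR'⟩ := h.exists_stepRight hR (by omega)
      have hb' := hR'.tile_right.bounds
      have e := hR'.x_eq
      obtain ⟨u, r, h0, h1, h2, h3⟩ := ih (M - R'.x₂).toNat (by omega) hR'.tile_right rfl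
      refine ⟨fun i => Nat.casesOn i R u, r + 1, by omega, rfl, fun i hi => ?_, ?_⟩
      · cases i with
        | zero => simpa [h1] using hR'
        | succ i => exact h2 i (by omega)
      · obtain ⟨r, rfl⟩ : ∃ t, r = t + 1 := ⟨r - 1, by omega⟩
        simpa using h3

lemma IsPerfectConfig.exists_tileGrid (h : IsPerfectConfig M N S) (hM : 0 < M) (hN : 0 < N) :
    ∃ (r s : ℕ) (T : ℕ → ℕ → IntRect), IsTileGrid M N S r s T := by
  obtain ⟨R, hR, c1, c2, c3, c4⟩ := h.exists_tile le_rfl hM le_rfl hN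
  have hb := hR.bounds
  obtain ⟨u, r, r_pos, u0, hu, hur⟩ := h.exists_row hR
  obtain ⟨v, s, s_pos, v0, hv, hvs⟩ := h.swap.exists_row (isTile_swap.2 hR)
  -- The first column consists of steps down, and each row iterates a chosen step to the right. The
  -- choice is irrelevant by uniqueness, and so is the value of `f` where no step exists.
  obtain ⟨f, hf⟩ : ∃ f : IntRect → IntRect, ∀ R, (∃ R', StepRight M N S R R') →
      StepRight M N S R (f R) := by
    classical
    exact ⟨fun R => if H : ∃ R', StepRight M N S R R' then H.choose else R,
      fun R H => by simpa [H] using H.choose_spec⟩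
  let T : ℕ → ℕ → IntRect := fun i j => f^[i] (v j).swap
  have hT : ∀ i j, T (i + 1) j = f (T i j) := fun i j => Function.iterate_succ_apply' f i _
  have hT0 : T 0 0 = R := by simp [T, v0]
  have hcol : ∀ j, j + 1 < s → StepDown M N S (T 0 j) (T 0 (j + 1)) := fun j hj => hv j hj
  have hrow : ∀ i, i < r → T i 0 = u i := by
    intro i
    induction i with
    | zero => exact fun _ => hT0.trans u0.symm
    | succ i ih =>
      intro hi
      have e := hu i hi
      rw [← ih (by omega)] at e
      rw [hT]
      exact (hf _ ⟨_, e⟩).unique h e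
  have hdown : ∀ j, j + 1 < s → (∀ i, i + 1 < r → StepRight M N S (T i j) (T (i + 1) j)) →
      ∀ i, i < r → StepDown M N S (T i j) (T i (j + 1)) := by
    intro j hj hr i
    induction i with
    | zero => exact fun _ => hcol j hj
    | succ i ih =>
      intro hi
      obtain ⟨X, h1, h2⟩ := (hr i hi).comm_stepDown h (ih (by omega))
      rw [hT i (j + 1), (hf _ ⟨_, h1⟩).unique h h1]
      exact h2
  -- Commutation carries each step of row `j` down to row `j + 1`, so all rows have the length of
  -- the first one.
  have hright : ∀ j, j < s → ∀ i, i + 1 < r → StepRight M N S (T i j) (T (i + 1) j) := by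
    intro j
    induction j with
    | zero =>
      intro _ i hi
      rw [hrow i (by omega), hrow (i + 1) hi]
      exact hu i hi
    | succ j ih =>
      intro hj i hi
      obtain ⟨X, h1, -⟩ := (ih (by omega) i hi).comm_stepDown h
        (hdown j hj (ih (by omega)) i (by omega))
      rw [hT]
      exact hf _ ⟨X, h1⟩
  refine ⟨r, s, T, r_pos, s_pos, ?_, fun i j hi hj => hright j hj i hi,
    fun i j hi hj => hdown j hj (hright j (by omega)) i hi, ?_, ?_, ?_, hvs⟩
  · intro i j hi hj
    cases i with
    | succ i => exact (hright j hj i hi).tile_right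
    | zero =>
      cases j with
      | succ j => exact (hcol j hj).tile_right
      | zero => rwa [hT0]
  · rw [hT0]; omega
  · rw [hT0]; omega
  · rw [hrow _ (by omega), hur]

namespace IsTileGrid

variable {r s : ℕ} {T : ℕ → ℕ → IntRect}

/-- The grid is anchored only at its first row and column. Steps preserve contact with the sides of
the region that they run along, which carries the anchoring to all rows and columns. -/
lemma x₁_zero (g : IsTileGrid M N S r s T) (h : IsPerfectConfig M N S) {j : ℕ} (hj : j < s) :
    (T 0 j).x₁ = 0 := by
  induction j with
  | zero => exact g.left_zero
  | succ j ih => exact ((g.down 0 j g.r_pos hj).bounds h).2.2.1.1 (ih (by omega))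

lemma y₁_zero (g : IsTileGrid M N S r s T) (h : IsPerfectConfig M N S) {i : ℕ} (hi : i < r) :
    (T i 0).y₁ = 0 := by
  induction i with
  | zero => exact g.top_zero
  | succ i ih => exact ((g.right i 0 hi g.s_pos).bounds h).2.2.1.1 (ih (by omega))

lemma x₂_end (g : IsTileGrid M N S r s T) (h : IsPerfectConfig M N S) {j : ℕ} (hj : j < s) :
    (T (r - 1) j).x₂ = M := by
  have := g.r_pos
  induction j with
  | zero => exact g.right_end
  | succ j ih => exact ((g.down (r - 1) j (by omega) hj).bounds h).2.2.2.1 (ih (by omega))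

lemma y₂_end (g : IsTileGrid M N S r s T) (h : IsPerfectConfig M N S) {i : ℕ} (hi : i < r) :
    (T i (s - 1)).y₂ = N := by
  have := g.s_pos
  induction i with
  | zero => exact g.bottom_end
  | succ i ih => exact ((g.right i (s - 1) hi (by omega)).bounds h).2.2.2.1 (ih (by omega))

lemma x₁_succ_pos (g : IsTileGrid M N S r s T) {i j : ℕ} (hi : i + 1 < r) (hj : j < s) :
    0 < (T (i + 1) j).x₁ := by
  rw [(g.right i j hi hj).x_eq]
  have := (g.tile i j (by omega) hj).bounds
  omega

lemma y₁_succ_pos (g : IsTileGrid M N S r s T) {i j : ℕ} (hi : i < r) (hj : j + 1 < s) :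
    0 < (T i (j + 1)).y₁ := by
  rw [(g.down i j hi hj).y_eq]
  have := (g.tile i j hi (by omega)).bounds
  omega

lemma x₂_lt (g : IsTileGrid M N S r s T) {i j : ℕ} (hi : i + 1 < r) (hj : j < s) :
    (T i j).x₂ < M := by
  rw [← (g.right i j hi hj).x_eq]
  have := (g.tile (i + 1) j hi hj).bounds
  omega

lemma y₂_lt (g : IsTileGrid M N S r s T) {i j : ℕ} (hi : i < r) (hj : j + 1 < s) :
    (T i j).y₂ < N := by
  rw [← (g.down i j hi hj).y_eq]
  have := (g.tile i (j + 1) hi hj).bounds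
  omega

lemma exists_eq_of_left (g : IsTileGrid M N S r s T) (h : IsPerfectConfig M N S) {R : IntRect}
    (hR : IsTile M N S R) (hx : R.x₁ = 0) : ∃ j < s, T 0 j = R := by
  induction hk : R.y₁.toNat using Nat.strong_induction_on generalizing R with
  | _ k ih =>
    have hb := hR.bounds
    by_cases hy : R.y₁ = 0
    · refine ⟨0, g.s_pos, (g.tile 0 0 g.r_pos g.s_pos).eq_of_hasCell hR (x := 0) (y := 0) ?_
        ⟨by omega, by omega, by omega, by omega⟩⟩
      have := (g.tile 0 0 g.r_pos g.s_pos).bounds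
      have := g.left_zero
      have := g.top_zero
      exact ⟨by omega, by omega, by omega, by omega⟩
    · obtain ⟨R', hR'⟩ := h.exists_stepUp hR (by omega)
      have hb' := hR'.tile_left.bounds
      have e := hR'.y_eq
      have hz := (hR'.bounds h).2.2.1.2 hx
      obtain ⟨j, hj, rfl⟩ := ih R'.y₁.toNat (by omega) hR'.tile_left hz rfl
      have hj' : j + 1 < s := by
        by_contra hc
        have := g.y₂_end h g.r_pos
        rw [show s - 1 = j by omega] at this
        omega
      exact ⟨j + 1, hj', (g.down 0 j g.r_pos hj').unique h hR'⟩

/-- A grid of tiles contains all tiles. -/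
lemma exists_eq (g : IsTileGrid M N S r s T) (h : IsPerfectConfig M N S) {R : IntRect}
    (hR : IsTile M N S R) : ∃ i j, i < r ∧ j < s ∧ T i j = R := by
  induction hk : R.x₁.toNat using Nat.strong_induction_on generalizing R with
  | _ k ih =>
    have hb := hR.bounds
    by_cases hx : R.x₁ = 0
    · obtain ⟨j, hj, e⟩ := g.exists_eq_of_left h hR hx
      exact ⟨0, j, g.r_pos, hj, e⟩
    -- The left neighbour is already in the grid. It is not in the last column, as it does not reach
    -- the right side, so the grid's next tile is `R` by uniqueness.
    · obtain ⟨R', hR'⟩ := h.exists_stepLeft hR (by omega)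
      have hb' := hR'.tile_left.bounds
      have e := hR'.x_eq
      obtain ⟨i, j, hi, hj, rfl⟩ := ih R'.x₁.toNat (by omega) hR'.tile_left rfl
      have hi' : i + 1 < r := by
        by_contra hc
        have := g.x₂_end h hj
        rw [show r - 1 = i by omega] at this
        omega
      exact ⟨i + 1, j, hi', hj, (g.right i j hi' hj).unique h hR'⟩

lemma inj_column (g : IsTileGrid M N S r s T) (h : IsPerfectConfig M N S) {j j' : ℕ}
    (hj : j < s) (hj' : j' < s) (e : T 0 j = T 0 j') : j = j' := by
  induction j generalizing j' with
  | zero =>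
    cases j' with
    | zero => rfl
    | succ j' =>
      have := g.y₁_succ_pos g.r_pos hj'
      rw [← e, g.top_zero] at this
      omega
  | succ j ih =>
    cases j' with
    | zero =>
      have := g.y₁_succ_pos g.r_pos hj
      rw [e, g.top_zero] at this
      omega
    | succ j' =>
      have h1 := g.down 0 j g.r_pos hj
      rw [e] at h1
      rw [ih (by omega) (by omega) (h1.unique_up h (g.down 0 j' g.r_pos hj'))]

/-- A grid of tiles contains every tile only once. -/
lemma inj (g : IsTileGrid M N S r s T) (h : IsPerfectConfig M N S) {i i' j j' : ℕ}
    (hi : i < r) (hi' : i' < r) (hj : j < s) (hj' : j' < s) (e : T i j = T i' j') :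
    i = i' ∧ j = j' := by
  induction i generalizing i' with
  | zero =>
    cases i' with
    | zero => exact ⟨rfl, g.inj_column h hj hj' e⟩
    | succ i' =>
      have := g.x₁_succ_pos hi' hj'
      rw [← e, g.x₁_zero h hj] at this
      omega
  | succ i ih =>
    cases i' with
    | zero =>
      have := g.x₁_succ_pos hi hj
      rw [e, g.x₁_zero h hj'] at this
      omega
    | succ i' =>
      have h1 := g.right i j hi hj
      rw [e] at h1
      have := ih (by omega) (by omega) (h1.unique_left h (g.right i' j' hi' hj'))
      omega

/-- Both grids start with the tile that contains the upper left cell, and every further tile is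
determined by a unique step. -/
lemma eq_of_lt {r' s' : ℕ} {T' : ℕ → ℕ → IntRect} (g : IsTileGrid M N S r s T)
    (g' : IsTileGrid M N S r' s' T') (h : IsPerfectConfig M N S) {i j : ℕ} (hi : i < r)
    (hi' : i < r') (hj : j < s) (hj' : j < s') : T i j = T' i j := by
  induction i with
  | zero =>
    induction j with
    | zero =>
      have := (g.tile 0 0 hi hj).bounds
      have := (g'.tile 0 0 hi' hj').bounds
      have := g.left_zero
      have := g.top_zero
      have := g'.left_zero
      have := g'.top_zero
      exact (g.tile 0 0 hi hj).eq_of_hasCell (g'.tile 0 0 hi' hj') (x := 0) (y := 0)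
        ⟨by omega, by omega, by omega, by omega⟩ ⟨by omega, by omega, by omega, by omega⟩
    | succ j ih =>
      have h1 := g.down 0 j hi hj
      rw [ih (by omega) (by omega)] at h1
      exact h1.unique h (g'.down 0 j hi' hj')
  | succ i ih =>
    have h1 := g.right i j hi hj
    rw [ih (by omega) (by omega)] at h1
    exact h1.unique h (g'.right i j hi' hj')

lemma r_le {r' s' : ℕ} {T' : ℕ → ℕ → IntRect} (g : IsTileGrid M N S r s T)
    (g' : IsTileGrid M N S r' s' T') (h : IsPerfectConfig M N S) : r ≤ r' := by
  by_contra hc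
  have := g'.r_pos
  have h1 := g.x₂_lt (i := r' - 1) (by omega) g.s_pos
  rw [g.eq_of_lt g' h (by omega) (by omega) g.s_pos g'.s_pos, g'.right_end] at h1
  omega

lemma s_le {r' s' : ℕ} {T' : ℕ → ℕ → IntRect} (g : IsTileGrid M N S r s T)
    (g' : IsTileGrid M N S r' s' T') (h : IsPerfectConfig M N S) : s ≤ s' := by
  by_contra hc
  have := g'.s_pos
  have h1 := g.y₂_lt (j := s' - 1) g.r_pos (by omega)
  rw [g.eq_of_lt g' h g.r_pos g'.r_pos (by omega) (by omega), g'.bottom_end] at h1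
  omega

lemma sum_width (g : IsTileGrid M N S r s T) (h : IsPerfectConfig M N S) {k j : ℕ} (hk : k < r)
    (hj : j < s) : ∑ i ∈ Finset.range (k + 1), ((T i j).x₂ - (T i j).x₁) = (T k j).x₂ := by
  induction k with
  | zero => simp [g.x₁_zero h hj]
  | succ k ih =>
    rw [Finset.sum_range_succ, ih (by omega), (g.right k j hk hj).x_eq]
    ring

lemma sum_height (g : IsTileGrid M N S r s T) (h : IsPerfectConfig M N S) {i k : ℕ} (hi : i < r)
    (hk : k < s) : ∑ j ∈ Finset.range (k + 1), ((T i j).y₂ - (T i j).y₁) = (T i k).y₂ := by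
  induction k with
  | zero => simp [g.y₁_zero h hi]
  | succ k ih =>
    rw [Finset.sum_range_succ, ih (by omega), (g.down i k hi hk).y_eq]
    ring

/-- Rooms and ladders alternate in a grid of tiles. -/
lemma isLadderRect_iff (g : IsTileGrid M N S r s T) {i j : ℕ} (hi : i < r) (hj : j < s) :
    (IsLadderRect M N S (T i j) ↔ IsLadderRect M N S (T 0 0)) ↔ (i + j) % 2 = 0 := by
  have hR : ∀ R R', StepRight M N S R R' → (IsLadderRect M N S R' ↔ ¬ IsLadderRect M N S R) := by
    rintro R R' ⟨-, ⟨h1, h2⟩ | ⟨h1, h2⟩⟩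
    · exact iff_of_true h2 h1.not_isLadderRect
    · exact iff_of_false h2.not_isLadderRect (not_not.2 h1)
  have hD : ∀ R R', StepDown M N S R R' → (IsLadderRect M N S R' ↔ ¬ IsLadderRect M N S R) := by
    rintro R R' ⟨-, ⟨h1, h2⟩ | ⟨h1, h2⟩⟩
    · exact iff_of_true (isLadderRect_swap.1 h2) (isRoomRect_swap.1 h1).not_isLadderRect
    · exact iff_of_false (isRoomRect_swap.1 h2).not_isLadderRect
        (not_not.2 (isLadderRect_swap.1 h1))
  induction i with
  | zero =>
    induction j with
    | zero => simp
    | succ j ih =>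
      have h1 := ih (by omega)
      rw [hD _ _ (g.down 0 j hi hj)]
      have : (0 + (j + 1)) % 2 = 0 ↔ ¬ (0 + j) % 2 = 0 := by omega
      tauto
  | succ i ih =>
    have h1 := ih (by omega)
    rw [hR _ _ (g.right i j hi hj)]
    have : (i + 1 + j) % 2 = 0 ↔ ¬ (i + j) % 2 = 0 := by omega
    tauto

/-- The rectangles of a grid of tiles determine the set `S`. -/
lemma mem_of_mem {S' : ℤ → ℤ → Prop} (g : IsTileGrid M N S r s T)
    (g' : IsTileGrid M N S' r s T) (h : IsPerfectConfig M N S) (h' : IsPerfectConfig M N S')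
    {x y : ℤ} (hS : S x y) : S' x y := by
  obtain ⟨R, hR, x1, x2, x3, x4⟩ := h.exists_room_of_mem hS
  obtain ⟨i, j, hi, hj, rfl⟩ := g.exists_eq h (Or.inl hR)
  rcases g'.tile i j hi hj with hT | hT
  · exact hT.inner x y x1 x2 x3 x4
  -- A ladder has width or height one and hence no interior lattice point.
  · have := hT.thin h'
    omega

end IsTileGrid

end Grid

/-! ### Translation of the grid graph and its rectangles to integer coordinates -/

/-- A lattice rectangle in terms of the integer coordinates of its sides. -/
def LatticeRect.toIntRect (R : LatticeRect) : IntRect := ⟨R.x, R.x + R.w, R.y, R.y + R.h⟩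

/-- The lattice rectangle with given nonnegative sides. -/
def IntRect.toLatticeRect (R : IntRect) : LatticeRect :=
  ⟨R.x₁.toNat, R.y₁.toNat, (R.x₂ - R.x₁).toNat, (R.y₂ - R.y₁).toNat⟩

lemma LatticeRect.toLatticeRect_toIntRect (R : LatticeRect) : R.toIntRect.toLatticeRect = R := by
  simp [IntRect.toLatticeRect, LatticeRect.toIntRect]

lemma LatticeRect.toIntRect_injective : Function.Injective LatticeRect.toIntRect :=
  Function.LeftInverse.injective LatticeRect.toLatticeRect_toIntRect

lemma IsTile.toIntRect_toLatticeRect {M N : ℤ} {S : ℤ → ℤ → Prop} {R : IntRect}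
    (h : IsTile M N S R) : R.toLatticeRect.toIntRect = R := by
  have := h.bounds
  ext <;> simp only [IntRect.toLatticeRect, LatticeRect.toIntRect] <;> omega

namespace GridPDS

variable (P : GridPDS)

/-- The perfect dominating set as a relation between the coordinates in the enlarged grid. -/
def mem (x y : ℤ) : Prop := ∃ v ∈ P.S, x = ((v.1 : ℕ) : ℤ) + 1 ∧ y = ((v.2 : ℕ) : ℤ) + 1

lemma mem_bounds {x y : ℤ} (h : P.mem x y) : 0 < x ∧ x < P.m + 1 ∧ 0 < y ∧ y < P.n + 1 := by
  obtain ⟨⟨a, b⟩, -, rfl, rfl⟩ := h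
  have := a.2
  have := b.2
  dsimp only
  omega

lemma mem_add_one (v : Fin P.m × Fin P.n) :
    P.mem (((v.1 : ℕ) : ℤ) + 1) (((v.2 : ℕ) : ℤ) + 1) ↔ v ∈ P.S := by
  refine ⟨?_, fun h => ⟨v, h, rfl, rfl⟩⟩
  rintro ⟨u, hu, h1, h2⟩
  obtain rfl : v = u := Prod.ext (Fin.ext (by omega)) (Fin.ext (by omega))
  exact hu

lemma mem_dom_iff (x y : ℕ) : (x, y) ∈ P.dom ↔ P.mem x y := by
  simp only [dom, mem, gridEmbed, Set.mem_image, Prod.mk.injEq]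
  refine exists_congr fun v => and_congr_right fun _ => ?_
  omega

lemma mem_hVertices_iff (v : ℕ × ℕ) :
    v ∈ P.hVertices ↔ v.1 ≤ P.m + 1 ∧ v.2 ≤ P.n + 1 ∧ ¬ P.mem v.1 v.2 := by
  obtain ⟨x, y⟩ := v
  constructor
  · rintro (⟨h1, h2, h3⟩ | ⟨u, hu, h⟩)
    · refine ⟨h1, h2, fun h => ?_⟩
      have := P.mem_bounds h
      dsimp only at *
      omega
    · simp only [gridEmbed, Prod.mk.injEq] at h
      obtain ⟨rfl, rfl⟩ := h
      have := u.1.2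
      have := u.2.2
      refine ⟨by dsimp; omega, by dsimp; omega, ?_⟩
      push_cast
      rw [P.mem_add_one]
      exact hu
  · rintro ⟨h1, h2, h3⟩
    dsimp only at h1 h2 h3
    by_cases hb : x = 0 ∨ x = P.m + 1 ∨ y = 0 ∨ y = P.n + 1
    · exact Or.inl ⟨h1, h2, hb⟩
    · refine Or.inr ⟨(⟨x - 1, by omega⟩, ⟨y - 1, by omega⟩), fun hS => h3 ⟨_, hS, ?_, ?_⟩, ?_⟩
      · dsimp; omega
      · dsimp; omega
      · simp only [gridEmbed, Prod.mk.injEq]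
        omega

lemma not_good_iff {x y : ℕ} (hx : x ≤ P.m) (hy : y ≤ P.n) :
    ¬ P.Good x y ↔ BadCell (P.m + 1) (P.n + 1) P.mem x y := by
  simp only [Good, mem_dom_iff, BadCell]
  push_cast
  have : (x : ℤ) < P.m + 1 := by omega
  have : (y : ℤ) < P.n + 1 := by omega
  simp only [Nat.cast_nonneg, true_and, not_or, *]

lemma isPerfectConfig : IsPerfectConfig (P.m + 1) (P.n + 1) P.mem := by
  have key : ∀ x y : ℤ, 0 < x → x < P.m + 1 → 0 < y → y < P.n + 1 → ¬ P.mem x y →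
      ∃ p q : ℤ, P.mem p q ∧ (p = x ∧ (q = y - 1 ∨ q = y + 1) ∨ q = y ∧ (p = x - 1 ∨ p = x + 1)) ∧
        ∀ p' q' : ℤ, P.mem p' q' →
          (p' = x ∧ (q' = y - 1 ∨ q' = y + 1) ∨ q' = y ∧ (p' = x - 1 ∨ p' = x + 1)) →
          p' = p ∧ q' = q := by
    intro x y h1 h2 h3 h4 hS
    have hv : (⟨⟨(x - 1).toNat, by omega⟩, ⟨(y - 1).toNat, by omega⟩⟩ : Fin P.m × Fin P.n) ∉ P.S :=
      fun hv => hS ⟨_, hv, by dsimp; omega, by dsimp; omega⟩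
    obtain ⟨u, ⟨hu, hadj⟩, huniq⟩ := P.isPDS _ hv
    refine ⟨((u.1 : ℕ) : ℤ) + 1, ((u.2 : ℕ) : ℤ) + 1, ⟨u, hu, rfl, rfl⟩, ?_, ?_⟩
    · simp only [boxProd_adj, pathGraph_adj, Fin.ext_iff] at hadj
      omega
    · rintro p q ⟨t, ht, rfl, rfl⟩ hpq
      have := huniq t ⟨ht, by
        simp only [boxProd_adj, pathGraph_adj, Fin.ext_iff]
        omega⟩
      subst this
      exact ⟨rfl, rfl⟩
  refine ⟨fun x y => P.mem_bounds, ?_, ?_, ?_, ?_⟩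
  · intro x y h1 h2 h3 h4 hS
    obtain ⟨p, q, hm, ⟨rfl, rfl | rfl⟩ | ⟨rfl, rfl | rfl⟩, -⟩ := key x y h1 h2 h3 h4 hS <;> tauto
  · rintro x y hS ⟨h1, h2⟩
    have b1 := P.mem_bounds h1
    have b2 := P.mem_bounds h2
    obtain ⟨p, q, -, -, hu⟩ := key x y (by omega) (by omega) (by omega) (by omega) hS
    have e1 := hu _ _ h1 (by omega)
    have e2 := hu _ _ h2 (by omega)
    omega
  · rintro x y hS ⟨h1, h2⟩
    have b1 := P.mem_bounds h1
    have b2 := P.mem_bounds h2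
    obtain ⟨p, q, -, -, hu⟩ := key x y (by omega) (by omega) (by omega) (by omega) hS
    have e1 := hu _ _ h1 (by omega)
    have e2 := hu _ _ h2 (by omega)
    omega
  · rintro x y i1 i2 i3 i4 hS ⟨h1, h2⟩
    obtain ⟨p, q, -, -, hu⟩ := key x y i1 i2 i3 i4 hS
    rcases h1 with h1 | h1 <;> rcases h2 with h2 | h2 <;>
    · have e1 := hu _ _ h1 (by omega)
      have e2 := hu _ _ h2 (by omega)
      omega

/-- A good cell has a corner in `S`, which cannot be on the boundary of the room. So a room has an
interior lattice point, and both its sides are at least two. -/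
lemma isRoom_iff {R : LatticeRect} :
    P.IsRoom R ↔ IsRoomRect (P.m + 1) (P.n + 1) P.mem R.toIntRect := by
  constructor
  · intro h
    obtain ⟨hw, hh, hx, hy⟩ := h.within
    have hcell : ∃ p q : ℕ, P.mem p q ∧ (p = R.x ∨ p = R.x + 1) ∧ (q = R.y ∨ q = R.y + 1) := by
      have := h.good R.x R.y ⟨by omega, by omega, by omega, by omega⟩
      simp only [Good, mem_dom_iff] at this
      rcases this with this | this | this | this <;> exact ⟨_, _, this, by simp, by simp⟩
    obtain ⟨p, q, hS, hp, hq⟩ := hcell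
    have hpq : R.HasInteriorPoint (p, q) := by
      by_contra hc
      have := h.boundary (p, q) ⟨by dsimp; omega, by dsimp; omega, by dsimp; omega,
        by dsimp; omega⟩ hc
      exact ((P.mem_hVertices_iff _).1 this).2.2 hS
    obtain ⟨i1, i2, i3, i4⟩ := hpq
    dsimp only at i1 i2 i3 i4
    refine ⟨?_, ?_, ?_, ?_, ?_, ?_, fun x y a b c d => ?_, fun x y a b c d e hS' => ?_⟩
    all_goals simp only [LatticeRect.toIntRect] at *
    · omega
    · omega
    · omega
    · omega
    · omega
    · omega
    · lift x to ℕ using by omega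
      lift y to ℕ using by omega
      have := h.interior (x, y) ⟨by dsimp; omega, by dsimp; omega, by dsimp; omega,
        by dsimp; omega⟩
      rw [mem_hVertices_iff] at this
      dsimp only at this
      by_contra hS'
      exact this ⟨by omega, by omega, hS'⟩
    · lift x to ℕ using by omega
      lift y to ℕ using by omega
      have := h.boundary (x, y) ⟨by dsimp; omega, by dsimp; omega, by dsimp; omega,
        by dsimp; omega⟩ (fun hI => by
          obtain ⟨i1, i2, i3, i4⟩ := hI
          dsimp only at i1 i2 i3 i4
          omega)
      exact ((P.mem_hVertices_iff _).1 this).2.2 hS'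
  · intro h
    have h1 := h.width
    have h2 := h.height
    have h3 := h.right
    have h4 := h.bottom
    have hin := h.inner
    have hout := h.outer
    simp only [LatticeRect.toIntRect] at h1 h2 h3 h4 hin hout
    refine ⟨⟨by omega, by omega, by omega, by omega⟩, fun x y hc => ?_, ?_, ?_⟩
    · obtain ⟨a, b, c, d⟩ := hc
      by_contra hb
      rw [P.not_good_iff (by omega) (by omega)] at hb
      refine h.not_badCell ⟨?_, ?_, ?_, ?_⟩ hb <;> simp only [LatticeRect.toIntRect] <;> omega
    · rintro ⟨x, y⟩ ⟨a, b, c, d⟩ hI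
      simp only [LatticeRect.HasInteriorPoint] at a b c d hI
      rw [mem_hVertices_iff]
      exact ⟨by dsimp; omega, by dsimp; omega,
        hout x y (by omega) (by omega) (by omega) (by omega) (by omega)⟩
    · rintro ⟨x, y⟩ ⟨a, b, c, d⟩
      dsimp only at a b c d
      rw [mem_hVertices_iff]
      exact fun hH => hH.2.2 (hin x y (by omega) (by omega) (by omega) (by omega))

lemma badCell_of_bad {R : LatticeRect} (hw : P.Within R) (hb : ∀ x y, R.HasCell x y → ¬ P.Good x y)
    {x y : ℤ} (h : R.toIntRect.HasCell x y) : BadCell (P.m + 1) (P.n + 1) P.mem x y := by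
  obtain ⟨a, b, c, d⟩ := h
  obtain ⟨-, -, w1, w2⟩ := hw
  simp only [LatticeRect.toIntRect] at a b c d
  lift x to ℕ using by omega
  lift y to ℕ using by omega
  exact (P.not_good_iff (by omega) (by omega)).1
    (hb x y ⟨by omega, by omega, by omega, by omega⟩)

/-- The ladder through one cell of a union of bad cells contains the whole union by `le_of_hasCell`.
Hence maximality among rectangles agrees with the absence of bad cells along the sides. -/
lemma isLadder_iff {R : LatticeRect} :
    P.IsLadder R ↔ IsLadderRect (P.m + 1) (P.n + 1) P.mem R.toIntRect := by
  constructor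
  · intro h
    have hbad := fun x y => P.badCell_of_bad (x := x) (y := y) h.within h.bad
    obtain ⟨hw, hh, hx, hy⟩ := h.within
    have hc : R.toIntRect.HasCell R.x R.y := by
      refine ⟨?_, ?_, ?_, ?_⟩ <;> simp only [LatticeRect.toIntRect] <;> omega
    obtain ⟨L, hL, hcL⟩ := P.isPerfectConfig.exists_ladder (hbad _ _ hc)
    obtain ⟨e1, e2, e3, e4⟩ := hL.le_of_hasCell hbad hcL hc
    obtain ⟨b1, b2, b3, b4, b5, b6⟩ := hL.bounds
    simp only [LatticeRect.toIntRect] at e1 e2 e3 e4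
    have : L.toLatticeRect = R := by
      refine h.maximal _ ⟨?_, ?_, ?_, ?_⟩ (fun x y hxy => ?_) (fun x y hxy => ?_)
      · simp only [IntRect.toLatticeRect]; omega
      · simp only [IntRect.toLatticeRect]; omega
      · simp only [IntRect.toLatticeRect]; omega
      · simp only [IntRect.toLatticeRect]; omega
      · obtain ⟨c1, c2, c3, c4⟩ := hxy
        simp only [IntRect.toLatticeRect] at c1 c2 c3 c4
        rw [P.not_good_iff (by omega) (by omega)]
        exact hL.bad _ _ (by omega) (by omega) (by omega) (by omega)
      · obtain ⟨c1, c2, c3, c4⟩ := hxy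
        refine ⟨?_, ?_, ?_, ?_⟩ <;> simp only [IntRect.toLatticeRect] <;> omega
    rw [← this, IsTile.toIntRect_toLatticeRect (Or.inr hL)]
    exact hL
  · intro h
    have hb := h.bounds
    simp only [LatticeRect.toIntRect] at hb
    refine ⟨⟨by omega, by omega, by omega, by omega⟩, fun x y hxy => ?_, fun R' hw hR' hsub => ?_⟩
    · obtain ⟨c1, c2, c3, c4⟩ := hxy
      rw [P.not_good_iff (by omega) (by omega)]
      refine h.bad _ _ ?_ ?_ ?_ ?_ <;> simp only [LatticeRect.toIntRect] <;> omega
    · have s1 := hsub R.x R.y ⟨by omega, by omega, by omega, by omega⟩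
      have s2 := hsub (R.x + R.w - 1) (R.y + R.h - 1) ⟨by omega, by omega, by omega, by omega⟩
      obtain ⟨a1, a2, a3, a4⟩ := s1
      obtain ⟨b1, b2, b3, b4⟩ := s2
      have := h.le_of_hasCell (fun x y => P.badCell_of_bad hw hR') (x := R.x) (y := R.y)
        (by refine ⟨?_, ?_, ?_, ?_⟩ <;> simp only [LatticeRect.toIntRect] <;> omega)
        (by refine ⟨?_, ?_, ?_, ?_⟩ <;> simp only [LatticeRect.toIntRect] <;> omega)
      apply LatticeRect.toIntRect_injective
      simp only [LatticeRect.toIntRect] at this ⊢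
      ext <;> dsimp only <;> omega

lemma isTile_toIntRect_iff {R : LatticeRect} :
    IsTile (P.m + 1) (P.n + 1) P.mem R.toIntRect ↔ P.IsRoom R ∨ P.IsLadder R := by
  rw [isRoom_iff, isLadder_iff, IsTile]

end GridPDS

/-! ### From a grid of tiles to a PDS-array -/

/-- A finite array of lattice rectangles as a function of all pairs of natural numbers. -/
def intRectGrid {r s : ℕ} (T : Fin r → Fin s → LatticeRect) (i j : ℕ) : IntRect :=
  if h : i < r ∧ j < s then (T ⟨i, h.1⟩ ⟨j, h.2⟩).toIntRect else ⟨0, 0, 0, 0⟩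

lemma intRectGrid_apply {r s : ℕ} (T : Fin r → Fin s → LatticeRect) {i j : ℕ} (hi : i < r)
    (hj : j < s) : intRectGrid T i j = (T ⟨i, hi⟩ ⟨j, hj⟩).toIntRect :=
  dif_pos ⟨hi, hj⟩

/-- The array of the widths and heights of a grid of rectangles. -/
def sizeArray (r s : ℕ) (T : ℕ → ℕ → IntRect) : PairArray where
  r := r
  s := s
  a i j := ((T i j).x₂ - (T i j).x₁).toNat
  b i j := ((T i j).y₂ - (T i j).y₁).toNat

lemma sum_Iic_fin {r : ℕ} (f : ℕ → ℤ) (k : Fin r) :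
    ∑ i ∈ Finset.Iic k, f i = ∑ i ∈ Finset.range (k + 1), f i := by
  rw [Nat.range_succ_eq_Iic, ← Fin.map_valEmbedding_Iic, Finset.sum_map]
  rfl

lemma IsTileGrid.isPDSArray {m n : ℕ} {A : PairArray} {S : ℤ → ℤ → Prop} {T : ℕ → ℕ → IntRect}
    (g : IsTileGrid (m + 1) (n + 1) S A.r A.s T) (h : IsPerfectConfig (m + 1) (n + 1) S)
    (hm : 0 < m) (hn : 0 < n) (δ : Fin 2)
    (hδ : ∀ i j, i < A.r → j < A.s → (i + j) % 2 = (δ : ℕ) →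
      IsLadderRect (m + 1) (n + 1) S (T i j))
    (hw : ∀ (i : Fin A.r) (j : Fin A.s), ((A.a i j : ℕ) : ℤ) = (T i j).x₂ - (T i j).x₁)
    (hh : ∀ (i : Fin A.r) (j : Fin A.s), ((A.b i j : ℕ) : ℤ) = (T i j).y₂ - (T i j).y₁) :
    IsPDSArray m n δ A := by
  have hb := fun (i : Fin A.r) (j : Fin A.s) => (g.tile i j i.2 j.2).bounds
  have hsw : ∀ (k : Fin A.r) (j : Fin A.s),
      ∑ i ∈ Finset.Iic k, ((A.a i j : ℕ) : ℤ) = (T k j).x₂ := fun k j => by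
    rw [← g.sum_width h k.2 j.2, ← sum_Iic_fin (fun i => (T i j).x₂ - (T i j).x₁)]
    exact Finset.sum_congr rfl fun i _ => hw i j
  have hsh : ∀ (i : Fin A.r) (k : Fin A.s),
      ∑ j ∈ Finset.Iic k, ((A.b i j : ℕ) : ℤ) = (T i k).y₂ := fun i k => by
    rw [← g.sum_height h i.2 k.2, ← sum_Iic_fin (fun j => (T i j).y₂ - (T i j).y₁)]
    exact Finset.sum_congr rfl fun j _ => hh i j
  have hD : ∀ (i : Fin A.r) (j j' : Fin A.s), (j' : ℕ) = (j : ℕ) + 1 →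
      |(T i j').x₁ - (T i j).x₁| ≤ 1 ∧ |(T i j').x₂ - (T i j).x₂| ≤ 1 := fun i j j' e => by
    have := (g.down i j i.2 (by omega)).bounds h
    rw [← e] at this
    exact ⟨this.1, this.2.1⟩
  have hR : ∀ (i i' : Fin A.r) (j : Fin A.s), (i' : ℕ) = (i : ℕ) + 1 →
      |(T i' j).y₁ - (T i j).y₁| ≤ 1 ∧ |(T i' j).y₂ - (T i j).y₂| ≤ 1 := fun i i' j e => by
    have := (g.right i j (by omega) j.2).bounds h
    rw [← e] at this
    exact ⟨this.1, this.2.1⟩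
  have hr := g.r_pos
  have hs := g.s_pos
  refine ⟨hm, hn, hr, hs, fun i j => ?_, fun i j => ?_, fun i j e => ?_, fun i j j' e => ?_,
    fun i i' j e => ?_, fun k j j' e => ?_, fun i i' k e => ?_, fun j => ?_, fun i => ?_⟩
  · have := hb i j
    have := hw i j
    omega
  · have := hb i j
    have := hh i j
    omega
  · have := (hδ i j i.2 j.2 e).thin h
    have := hw i j
    have := hh i j
    omega
  · obtain ⟨h1, h2⟩ := hD i j j' e
    -- A width is the difference of two coordinates, each of which changes by at most one.
    rw [hw, hw]
    rw [abs_le] at *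
    omega
  · obtain ⟨h1, h2⟩ := hR i i' j e
    rw [hh, hh]
    rw [abs_le] at *
    omega
  · rw [hsw, hsw]
    exact (hD k j j' e).2
  · rw [hsh, hsh]
    exact (hR i i' k e).2
  · have e := hsw ⟨A.r - 1, by omega⟩ j
    rw [show Finset.Iic (⟨A.r - 1, by omega⟩ : Fin A.r) = Finset.univ from
      Finset.eq_univ_of_forall fun i => Finset.mem_Iic.2 (Fin.le_def.2 (by dsimp; omega)),
      g.x₂_end h j.2] at e
    exact_mod_cast e
  · have e := hsh i ⟨A.s - 1, by omega⟩
    rw [show Finset.Iic (⟨A.s - 1, by omega⟩ : Fin A.s) = Finset.univ from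
      Finset.eq_univ_of_forall fun i => Finset.mem_Iic.2 (Fin.le_def.2 (by dsimp; omega)),
      g.y₂_end h i.2] at e
    exact_mod_cast e

/-! ### Arrangements and grids of tiles -/

namespace GridPDS

variable (P : GridPDS)

lemma rightOf_toIntRect {R R' : LatticeRect} :
    R.toIntRect.RightOf R'.toIntRect ↔ R.RightOf R' := by
  simp only [IntRect.RightOf, LatticeRect.toIntRect, LatticeRect.RightOf]
  omega

lemma below_toIntRect {R R' : LatticeRect} :
    R.toIntRect.swap.RightOf R'.toIntRect.swap ↔ R.Below R' := by
  simp only [IntRect.RightOf, LatticeRect.toIntRect, LatticeRect.Below, IntRect.swap]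
  omega

lemma hasCell_toIntRect {R : LatticeRect} {x y : ℕ} :
    R.toIntRect.HasCell x y ↔ R.HasCell x y := by
  simp only [IntRect.HasCell, LatticeRect.toIntRect, LatticeRect.HasCell]
  omega

-- An arrangement does not mention the border of the region; the tiling condition supplies it. Tiles
-- with positive column or row index have positive `x` or `y`, so the upper left cell lies in `T 0
-- 0`. The tiles at the ends of the first row and column are found from the cells at the other
-- corners.
variable {P} in
lemma IsArrangement.isTileGrid {δ : Fin 2} {r s : ℕ} {T : Fin r → Fin s → LatticeRect}
    (hT : P.IsArrangement δ T) :
    IsTileGrid (P.m + 1) (P.n + 1) P.mem r s (intRectGrid T) := by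
  have htile : ∀ i j, IsTile (P.m + 1) (P.n + 1) P.mem (T i j).toIntRect := fun i j => by
    rw [P.isTile_toIntRect_iff]
    by_cases e : ((i : ℕ) + (j : ℕ)) % 2 = (δ : ℕ)
    · exact Or.inr (hT.ladder i j e)
    · exact Or.inl (hT.room i j e)
  have hkind : ∀ (i : Fin r) (j : Fin s) (i' : Fin r) (j' : Fin s),
      ((i' : ℕ) + (j' : ℕ)) = (i : ℕ) + (j : ℕ) + 1 →
      (IsRoomRect (P.m + 1) (P.n + 1) P.mem (T i j).toIntRect ∧
        IsLadderRect (P.m + 1) (P.n + 1) P.mem (T i' j').toIntRect ∨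
      IsLadderRect (P.m + 1) (P.n + 1) P.mem (T i j).toIntRect ∧
        IsRoomRect (P.m + 1) (P.n + 1) P.mem (T i' j').toIntRect) := fun i j i' j' e => by
    simp only [← P.isRoom_iff, ← P.isLadder_iff]
    have := δ.2
    by_cases e' : ((i : ℕ) + (j : ℕ)) % 2 = (δ : ℕ)
    · exact Or.inr ⟨hT.ladder i j e', hT.room i' j' (by omega)⟩
    · exact Or.inl ⟨hT.room i j e', hT.ladder i' j' (by omega)⟩
  have hright : ∀ (i i' : Fin r) (j : Fin s), (i' : ℕ) = (i : ℕ) + 1 →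
      StepRight (P.m + 1) (P.n + 1) P.mem (T i j).toIntRect (T i' j).toIntRect := fun i i' j e =>
    ⟨rightOf_toIntRect.2 (hT.right i i' j e), hkind _ _ _ _ (by omega)⟩
  have hdown : ∀ (i : Fin r) (j j' : Fin s), (j' : ℕ) = (j : ℕ) + 1 →
      StepDown (P.m + 1) (P.n + 1) P.mem (T i j).toIntRect (T i j').toIntRect := fun i j j' e => by
    refine ⟨below_toIntRect.2 (hT.below i j j' e), ?_⟩
    simp only [isRoomRect_swap, isLadderRect_swap]
    exact hkind _ _ _ _ (by omega)
  have hx0 : ∀ (i : Fin r) (j : Fin s), (T i j).x = 0 → (i : ℕ) = 0 := fun i j e => by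
    by_contra hne
    have h1 := hright ⟨i - 1, by omega⟩ i j (by dsimp; omega)
    have h2 := h1.x_eq
    have h3 := h1.tile_left.bounds
    simp only [LatticeRect.toIntRect] at h2 h3
    omega
  have hy0 : ∀ (i : Fin r) (j : Fin s), (T i j).y = 0 → (j : ℕ) = 0 := fun i j e => by
    by_contra hne
    have h1 := hdown i ⟨j - 1, by omega⟩ j (by dsimp; omega)
    have h2 := h1.y_eq
    have h3 := h1.tile_left.bounds
    simp only [LatticeRect.toIntRect] at h2 h3
    omega
  have hr0 : ∃ (hr : 0 < r) (hs : 0 < s), (T ⟨0, hr⟩ ⟨0, hs⟩).x = 0 ∧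
      (T ⟨0, hr⟩ ⟨0, hs⟩).y = 0 := by
    obtain ⟨⟨⟨i, hi⟩, ⟨j, hj⟩⟩, ⟨c1, c2, c3, c4⟩, -⟩ := hT.tiles 0 0 (by omega) (by omega)
    dsimp only at c1 c2 c3 c4
    obtain rfl : i = 0 := hx0 ⟨i, hi⟩ ⟨j, hj⟩ (by omega)
    obtain rfl : j = 0 := hy0 ⟨_, hi⟩ ⟨j, hj⟩ (by omega)
    exact ⟨hi, hj, by omega, by omega⟩
  obtain ⟨hr, hs, ex, ey⟩ := hr0
  have hxe : (T ⟨r - 1, by omega⟩ ⟨0, hs⟩).toIntRect.x₂ = P.m + 1 := by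
    obtain ⟨⟨⟨i, hi⟩, ⟨j, hj⟩⟩, ⟨c1, c2, c3, c4⟩, -⟩ := hT.tiles P.m 0 (by omega) (by omega)
    dsimp only at c1 c2 c3 c4
    obtain rfl : j = 0 := hy0 ⟨_, hi⟩ ⟨j, hj⟩ (by omega)
    have hb := (htile ⟨i, hi⟩ ⟨0, hj⟩).bounds
    simp only [LatticeRect.toIntRect] at hb
    obtain rfl : i = r - 1 := by
      by_contra hne
      have h1 := hright ⟨i, hi⟩ ⟨i + 1, by omega⟩ ⟨0, hj⟩ rfl
      have h2 := h1.x_eq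
      have h3 := h1.tile_right.bounds
      simp only [LatticeRect.toIntRect] at h2 h3
      omega
    simp only [LatticeRect.toIntRect]
    omega
  have hye : (T ⟨0, hr⟩ ⟨s - 1, by omega⟩).toIntRect.y₂ = P.n + 1 := by
    obtain ⟨⟨⟨i, hi⟩, ⟨j, hj⟩⟩, ⟨c1, c2, c3, c4⟩, -⟩ := hT.tiles 0 P.n (by omega) (by omega)
    dsimp only at c1 c2 c3 c4
    obtain rfl : i = 0 := hx0 ⟨i, hi⟩ ⟨j, hj⟩ (by omega)
    have hb := (htile ⟨0, hi⟩ ⟨j, hj⟩).bounds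
    simp only [LatticeRect.toIntRect] at hb
    obtain rfl : j = s - 1 := by
      by_contra hne
      have h1 := hdown ⟨0, hi⟩ ⟨j, hj⟩ ⟨j + 1, by omega⟩ rfl
      have h2 := h1.y_eq
      have h3 := h1.tile_right.bounds
      simp only [LatticeRect.toIntRect] at h2 h3
      omega
    simp only [LatticeRect.toIntRect]
    omega
  refine ⟨hr, hs, fun i j hi hj => ?_, fun i j hi hj => ?_, fun i j hi hj => ?_, ?_, ?_, ?_, ?_⟩
  · rw [intRectGrid_apply T hi hj]
    exact htile _ _
  · rw [intRectGrid_apply T hi hj, intRectGrid_apply T (by omega) hj]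
    exact hright _ _ _ rfl
  · rw [intRectGrid_apply T hi hj, intRectGrid_apply T hi (by omega)]
    exact hdown _ _ _ rfl
  · rw [intRectGrid_apply T hr hs]
    simp only [LatticeRect.toIntRect]
    omega
  · rw [intRectGrid_apply T hr hs]
    simp only [LatticeRect.toIntRect]
    omega
  · rw [intRectGrid_apply T (by omega) hs, hxe]
  · rw [intRectGrid_apply T hr (by omega), hye]

lemma isArrangement_of_isTileGrid {δ : Fin 2} {r s : ℕ} {T : ℕ → ℕ → IntRect}
    (g : IsTileGrid (P.m + 1) (P.n + 1) P.mem r s T)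
    (hδ : ∀ i j, i < r → j < s →
      ((i + j) % 2 = (δ : ℕ) ↔ IsLadderRect (P.m + 1) (P.n + 1) P.mem (T i j))) :
    P.IsArrangement δ (fun (i : Fin r) (j : Fin s) => (T i j).toLatticeRect) := by
  have h := P.isPerfectConfig
  have hT : ∀ (i : Fin r) (j : Fin s), (T i j).toLatticeRect.toIntRect = T i j := fun i j =>
    (g.tile i j i.2 j.2).toIntRect_toLatticeRect
  have hinj : ∀ (i i' : Fin r) (j j' : Fin s), T i j = T i' j' → i = i' ∧ j = j' :=
    fun i i' j j' e => by
      have := g.inj h i.2 i'.2 j.2 j'.2 e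
      exact ⟨Fin.ext this.1, Fin.ext this.2⟩
  refine ⟨fun i j e => ?_, fun i j e => ?_, fun i i' j j' e => ?_, fun R hR => ?_,
    fun x y hx hy => ?_, fun i i' j e => ?_, fun i j j' e => ?_⟩
  · rw [isLadder_iff, hT]
    exact (hδ i j i.2 j.2).1 e
  · rw [isRoom_iff, hT]
    exact (g.tile i j i.2 j.2).resolve_right (mt (hδ i j i.2 j.2).2 e)
  · refine hinj i i' j j' ?_
    rw [← hT i j, ← hT i' j', e]
  · obtain ⟨i, j, hi, hj, e⟩ := g.exists_eq h (P.isTile_toIntRect_iff.2 hR)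
    refine ⟨⟨i, hi⟩, ⟨j, hj⟩, ?_⟩
    dsimp only
    rw [e, LatticeRect.toLatticeRect_toIntRect]
  · obtain ⟨R, hR, hc⟩ := h.exists_tile (x := x) (y := y) (by omega) (by omega) (by omega)
      (by omega)
    obtain ⟨i, j, hi, hj, rfl⟩ := g.exists_eq h hR
    refine ⟨(⟨i, hi⟩, ⟨j, hj⟩), ?_, ?_⟩
    · dsimp only
      rw [← hasCell_toIntRect, hT ⟨i, hi⟩ ⟨j, hj⟩]
      exact hc
    · rintro ⟨i', j'⟩ hc'
      dsimp only at hc'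
      rw [← hasCell_toIntRect, hT] at hc'
      have := hinj i' ⟨i, hi⟩ j' ⟨j, hj⟩
        ((g.tile i' j' i'.2 j'.2).eq_of_hasCell hR hc' hc)
      exact Prod.ext this.1 this.2
  · rw [← rightOf_toIntRect, hT, hT, e]
    exact (g.right i j (by omega) j.2).1
  · rw [← below_toIntRect, hT, hT, e]
    exact (g.down i j i.2 (by omega)).1

lemma exists_isRoomLadderArray :
    ∃ (A : PairArray) (δ : Fin 2), IsPDSArray P.m P.n δ A ∧ P.IsRoomLadderArray δ A := by
  classical
  have h := P.isPerfectConfig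
  obtain ⟨r, s, T, g⟩ := h.exists_tileGrid (by omega) (by omega)
  -- The parity is fixed by the upper left tile: `0` for a ladder, `1` for a room.
  obtain ⟨δ, hδ⟩ : ∃ δ : Fin 2, ∀ i j, i < r → j < s →
      ((i + j) % 2 = (δ : ℕ) ↔ IsLadderRect (P.m + 1) (P.n + 1) P.mem (T i j)) := by
    by_cases h0 : IsLadderRect (P.m + 1) (P.n + 1) P.mem (T 0 0)
    · refine ⟨0, fun i j hi hj => ?_⟩
      have := g.isLadderRect_iff hi hj
      simp only [Fin.val_zero]
      tauto
    · refine ⟨1, fun i j hi hj => ?_⟩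
      have := g.isLadderRect_iff hi hj
      have e : (i + j) % 2 = 1 ↔ ¬ (i + j) % 2 = 0 := by omega
      simp only [Fin.val_one]
      tauto
  exact ⟨sizeArray r s T, δ,
    IsTileGrid.isPDSArray (A := sizeArray r s T) g h P.m_pos P.n_pos δ
      (fun i j hi hj => (hδ i j hi hj).1)
      (fun i j => Int.toNat_of_nonneg (by have := (g.tile i j i.2 j.2).bounds; omega))
      (fun i j => Int.toNat_of_nonneg (by have := (g.tile i j i.2 j.2).bounds; omega)),
    _, P.isArrangement_of_isTileGrid g hδ, fun i j => ⟨rfl, rfl⟩⟩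

/-! ### Uniqueness of the array and injectivity -/

variable {P} in
lemma IsRoomLadderArray.exists_isTileGrid {δ : Fin 2} {A : PairArray}
    (hA : P.IsRoomLadderArray δ A) : ∃ T, IsTileGrid (P.m + 1) (P.n + 1) P.mem A.r A.s T ∧
      ∀ i j, ((A.a i j : ℕ) : ℤ) = (T i j).x₂ - (T i j).x₁ ∧
        ((A.b i j : ℕ) : ℤ) = (T i j).y₂ - (T i j).y₁ := by
  obtain ⟨T, hT, hs⟩ := hA
  refine ⟨intRectGrid T, hT.isTileGrid, fun i j => ?_⟩
  rw [intRectGrid_apply T i.2 j.2, (hs i j).1, (hs i j).2]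
  simp [LatticeRect.toIntRect]

variable {P} in
lemma IsRoomLadderArray.unique {δ δ' : Fin 2} {A A' : PairArray}
    (hA : P.IsRoomLadderArray δ A) (hA' : P.IsRoomLadderArray δ' A') : A = A' := by
  have h := P.isPerfectConfig
  obtain ⟨T, g, hT⟩ := hA.exists_isTileGrid
  obtain ⟨T', g', hT'⟩ := hA'.exists_isTileGrid
  clear hA hA'
  obtain ⟨r, s, a, b⟩ := A
  obtain ⟨r', s', a', b'⟩ := A'
  dsimp only at *
  obtain rfl : r = r' := le_antisymm (g.r_le g' h) (g'.r_le g h)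
  obtain rfl : s = s' := le_antisymm (g.s_le g' h) (g'.s_le g h)
  have e : ∀ (i : Fin r) (j : Fin s), T i j = T' i j := fun i j =>
    g.eq_of_lt g' h i.2 i.2 j.2 j.2
  have ea : a = a' := by
    funext i j
    have h1 := (hT i j).1
    have h2 := (hT' i j).1
    rw [e] at h1
    omega
  have eb : b = b' := by
    funext i j
    have h1 := (hT i j).2
    have h2 := (hT' i j).2
    rw [e] at h1
    omega
  rw [ea, eb]

/-- The array of the sizes of rooms and ladders determines the perfect dominating set. -/
lemma eq_of_isRoomLadderArray {P Q : GridPDS} {δ δ' : Fin 2} {A : PairArray}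
    (hP : P.IsRoomLadderArray δ A) (hQ : Q.IsRoomLadderArray δ' A) : P = Q := by
  have h := P.isPerfectConfig
  have h' := Q.isPerfectConfig
  obtain ⟨T, g, hT⟩ := hP.exists_isTileGrid
  obtain ⟨T', g', hT'⟩ := hQ.exists_isTileGrid
  have hw : ∀ i j, i < A.r → j < A.s → (T i j).x₂ - (T i j).x₁ = (T' i j).x₂ - (T' i j).x₁ :=
    fun i j hi hj => (hT ⟨i, hi⟩ ⟨j, hj⟩).1.symm.trans (hT' ⟨i, hi⟩ ⟨j, hj⟩).1
  have hh : ∀ i j, i < A.r → j < A.s → (T i j).y₂ - (T i j).y₁ = (T' i j).y₂ - (T' i j).y₁ :=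
    fun i j hi hj => (hT ⟨i, hi⟩ ⟨j, hj⟩).2.symm.trans (hT' ⟨i, hi⟩ ⟨j, hj⟩).2
  -- Right and lower sides are partial sums of widths and heights, so equal sizes give equal
  -- rectangles.
  have hTT : ∀ i j, i < A.r → j < A.s → T i j = T' i j := fun i j hi hj => by
    have e1 := hw i j hi hj
    have e2 := hh i j hi hj
    have e3 : (T i j).x₂ = (T' i j).x₂ := by
      rw [← g.sum_width h hi hj, ← g'.sum_width h' hi hj]
      exact Finset.sum_congr rfl fun k hk => hw k j (by have := Finset.mem_range.1 hk; omega) hj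
    have e4 : (T i j).y₂ = (T' i j).y₂ := by
      rw [← g.sum_height h hi hj, ← g'.sum_height h' hi hj]
      exact Finset.sum_congr rfl fun k hk => hh i k hi (by have := Finset.mem_range.1 hk; omega)
    ext <;> omega
  have hr := g.r_pos
  have hs := g.s_pos
  have em : P.m = Q.m := by
    have e := g.right_end
    rw [hTT _ _ (by omega) hs, g'.right_end] at e
    omega
  have en : P.n = Q.n := by
    have e := g.bottom_end
    rw [hTT _ _ hr (by omega), g'.bottom_end] at e
    omega
  have g'' : IsTileGrid (Q.m + 1) (Q.n + 1) Q.mem A.r A.s T := by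
    refine ⟨hr, hs, fun i j hi hj => ?_, fun i j hi hj => ?_, fun i j hi hj => ?_, ?_, ?_, ?_, ?_⟩
    · rw [hTT i j hi hj]
      exact g'.tile i j hi hj
    · rw [hTT i j (by omega) hj, hTT _ j hi hj]
      exact g'.right i j hi hj
    · rw [hTT i j hi (by omega), hTT i _ hi hj]
      exact g'.down i j hi hj
    · exact g.left_zero
    · exact g.top_zero
    · rw [← em]; exact g.right_end
    · rw [← en]; exact g.bottom_end
  have hS : ∀ x y, P.mem x y ↔ Q.mem x y := by
    rw [← em, ← en] at g'' h'
    exact fun x y => ⟨g.mem_of_mem g'' h h', g''.mem_of_mem g h' h⟩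
  clear g g' g'' hT hT' hTT hw hh hP hQ h h'
  obtain ⟨m, n, hm, hn, S, hS1⟩ := P
  obtain ⟨m', n', hm', hn', S', hS1'⟩ := Q
  dsimp only at em en
  subst em en
  have : S = S' := by
    ext v
    rw [← GridPDS.mem_add_one ⟨m, n, hm, hn, S, hS1⟩ v, hS,
      GridPDS.mem_add_one ⟨m, n, hm, hn, S', hS1'⟩ v]
  subst this
  rfl

end GridPDS

theorem theorem5p1 :
    ∃ φ : GridPDS → PDSArray, Function.Injective φ ∧
      ∀ P : GridPDS,
        (∃ δ : Fin 2, IsPDSArray P.m P.n δ (φ P).val ∧ P.IsRoomLadderArray δ (φ P).val) ∧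
        (∀ (A : PairArray) (δ : Fin 2), P.IsRoomLadderArray δ A → A = (φ P).val) := by
  choose A δ hA hT using GridPDS.exists_isRoomLadderArray
  refine ⟨fun P => ⟨A P, P.m, P.n, δ P, hA P⟩, fun P Q e => ?_, fun P => ⟨⟨δ P, hA P, hT P⟩,
    fun A' δ' hA' => hA'.unique (hT P)⟩⟩
  have e' : A P = A Q := congrArg Subtype.val e
  have hQ := hT Q
  rw [← e'] at hQ
  exact GridPDS.eq_of_isRoomLadderArray (hT P) hQ
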